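/- **Odd RSK Correspondence I.** Let $\mu,\rho$ be partitions of $n$, with $\ell(\mu)$ and $\ell(\rho)$ parts. *Definitions.* Write $\langle k\rangle=\tfrac12k(k+1)$ and $\langle\lambda\rangle=\sum_i\langle\lambda_i\rangle$ for a partition $\lambda$; $\lambda^T$ is the transpose. - For an $\ell(\mu)\times\ell(\rho)$ matrix $A$ with entries in $\mathbb N=\{0,1,2,\dots\}$, let $\mathrm{sign}(A)$ be the product of the factors $(-1)^{ab}$ over all pairs of entries in which $a$ lies strictly below and strictly to the left of $b$. - For a word $w$ in positive integers, $\mathrm{sign}(w)$ is the sign of the minimal length permutation that sorts $w$ into non-decreasing order. For a semistandard Young tableau $T$, $\mathrm{sign}(T)$ is the sign of its row word (entries read from left to right, bottom row to top row), and $\mathrm{cont}(T)=(a_1,a_2,\dots)$ where $a_i$ is the number of entries equal to $i$. The odd Kostka number is $K_{\lambda\mu}=\mathrm{sign}(T_\lambda)\sum_T\mathrm{sign}(T)$, the sum over the semistandard tableaux $T$ of shape $\lambda$ and content $\mu$, where $T_\lambda$ is the semistandard tableau of shape and content $\lambda$. - Let $\Bbbk$ be a commutative ring and $\Lambda'$ the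 free associative $\Bbbk$-algebra on $h_1,h_2,\dots$, with the bilinear form given on words $h_\alpha=h_{a_1}\cdots h_{a_r}$ by $(h_\beta,h_\alpha)=\sum_{c\in S_\beta\backslash S_n/S_\alpha}(-1)^{\ell(c)}$ if $|\alpha|=|\beta|=n$ and $(h_\beta,h_\alpha)=0$ if $|\alpha|\neq|\beta|$; here $S_\alpha=S_{a_1}\times\cdots\times S_{a_r}\subset S_n$, and $\ell(c)$ is the Coxeter length of the minimal length representative of $c$. The algebra $\Lambda$ of odd symmetric functions is the quotient of $\Lambda'$ by the radical of the form, with the induced form. Put $M'_{\mu\rho}=(h_\mu,h_\rho)\in\Bbbk$. - The RSK map sends $A$ to $(P,Q)$ as follows. List the positions $(u_j,v_j)=(\text{row},\text{column})$ of the entries of $A$, reading $A$ from left to right and top to bottom and repeating the position of an entry $a$ exactly $a$ times. Starting from empty tableaux, for $j=1,2,\dots,n$ row-insert $v_j$ (Schensted insertion) into $P$, and add to $Q$ a box with entry $u_j$ where the new box of $P$ has appeared. *Theorem.* The RSK map is a bijection from the set of $\ell(\mu)\times\ell(\rho)$ $\mathbb N$-matrices $A$ with row sums $\mu$ and column sums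 $\rho$ to the set of pairs $(P,Q)$ of semistandard Young tableaux of the same shape with $\mathrm{cont}(P)=\rho$ and $\mathrm{cont}(Q)=\mu$. If $A$ corresponds to $(P,Q)$ and $\lambda$ is the common shape of $P$ and $Q$, then $$\mathrm{sign}(A)=(-1)^{\langle\lambda^T\rangle+|\lambda|}\,\mathrm{sign}(P)\,\mathrm{sign}(Q).$$ In particular, in $\Bbbk$, $$M'_{\mu\rho}=\sum_{\lambda\vdash n}(-1)^{\langle\lambda^T\rangle+|\lambda|}K_{\lambda\mu}K_{\lambda\rho}=\sum_{\lambda\vdash n}(-1)^{\lambda_2+\lambda_4+\lambda_6+\cdots}K_{\lambda\mu}K_{\lambda\rho}.$$ -/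

import Mathlib

/-! Partitions are Young diagrams: `μ.rowLen i` is the part `μ_{i+1}` (zero beyond the last row),
`μ.colLen 0` is the number of parts and `μ.card` is the size `|μ|`.  Rows, columns and the letters
of tableaux are numbered from `0`, so the letter `k` of a tableau stands for `k + 1`. -/

namespace OddRSK

noncomputable section

/-! ### Lengths of permutations and the bilinear form -/

/-- The Coxeter length of a permutation: its number of inversions. -/
def invCount {n : ℕ} (σ : Equiv.Perm (Fin n)) : ℕ :=
  (Finset.univ.filter fun p : Fin n × Fin n => p.1 < p.2 ∧ σ p.2 < σ p.1).card

/-- If `0, 1, 2, …` are cut into consecutive blocks of sizes `a_0, a_1, …` (the entries of `α`),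
this is the index of the block that contains `i`: the number of `j` with
`a_0 + ⋯ + a_j ≤ i`. -/
def blockIndex (α : List ℕ) (i : ℕ) : ℕ :=
  ((Finset.range α.length).filter fun j => (α.take (j + 1)).sum ≤ i).card

/-- The parabolic (Young) subgroup `S_α` of `S_n`: the permutations which preserve every block of
the decomposition `α` of `n`. -/
def youngSubgroup (n : ℕ) (α : List ℕ) : Subgroup (Equiv.Perm (Fin n)) where
  carrier := {σ | ∀ i, blockIndex α (σ i) = blockIndex α i}
  one_mem' _ := rfl
  mul_mem' {σ τ} hσ hτ i := (hσ (τ i)).trans (hτ i)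
  inv_mem' {σ} hσ i := by
    have h := hσ (σ⁻¹ i)
    have e : σ (σ⁻¹ i) = i := by simp
    rw [e] at h
    exact h.symm

/-- The length of a double coset `c` in `S_β \ S_n / S_α`: the length of its minimal length
representative. -/
def doubleCosetLength {n : ℕ} {β α : List ℕ}
    (c : DoubleCoset.Quotient (youngSubgroup n β : Set (Equiv.Perm (Fin n)))
      (youngSubgroup n α : Set (Equiv.Perm (Fin n)))) : ℕ :=
  sInf {l | ∃ σ : Equiv.Perm (Fin n),
    DoubleCoset.mk (youngSubgroup n β) (youngSubgroup n α) σ = c ∧ invCount σ = l}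

instance {n : ℕ} {β α : List ℕ} :
    Finite (DoubleCoset.Quotient (youngSubgroup n β : Set (Equiv.Perm (Fin n)))
      (youngSubgroup n α : Set (Equiv.Perm (Fin n)))) :=
  inferInstanceAs (Finite (Quotient (DoubleCoset.setoid
    (youngSubgroup n β : Set (Equiv.Perm (Fin n))) (youngSubgroup n α))))

/-- The number `∑_c (-1)^{ℓ(c)}`, over the double cosets `c` in `S_β \ S_n / S_α`, if `α` and `β`
are decompositions of the same `n`; zero if they are not. -/
def doubleCosetSum (β α : List ℕ) : ℤ :=
  if β.sum = α.sum then
    ∑ᶠ c : DoubleCoset.Quotient (youngSubgroup α.sum β : Set (Equiv.Perm (Fin α.sum)))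
      (youngSubgroup α.sum α : Set (Equiv.Perm (Fin α.sum))), (-1) ^ doubleCosetLength c
  else 0

/-- The free associative algebra `Λ'` on generators `h_1, h_2, …`. -/
abbrev FreeOddAlgebra (k : Type*) [CommRing k] : Type _ := FreeAlgebra k ℕ+

/-- The odd (`q = -1`) bilinear form on `Λ'`, determined on the basis of words
`h_α = h_{a_1} ⋯ h_{a_r}` by `(h_β, h_α) = ∑_c (-1)^{ℓ(c)}`.  The algebra `Λ` of odd symmetric
functions is the quotient of `Λ'` by the radical of this form, with the induced form, so that the
form on `Λ` is computed by this one. -/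
def oddForm (k : Type*) [CommRing k] : LinearMap.BilinForm k (FreeOddAlgebra k) :=
  (FreeAlgebra.basisFreeMonoid k ℕ+).constr k fun β =>
    (FreeAlgebra.basisFreeMonoid k ℕ+).constr k fun α =>
      ((doubleCosetSum ((FreeMonoid.toList β).map PNat.val) ((FreeMonoid.toList α).map PNat.val) :
        ℤ) : k)

/-- The generator `h_m`, with `h_0 = 1`. -/
def hGen (k : Type*) [CommRing k] (m : ℕ) : FreeOddAlgebra k :=
  if hm : 0 < m then FreeAlgebra.ι k (⟨m, hm⟩ : ℕ+) else 1

/-- The odd complete symmetric function `h_μ = h_{μ_1} h_{μ_2} ⋯ h_{μ_r}`. -/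
def hPart (k : Type*) [CommRing k] (μ : YoungDiagram) : FreeOddAlgebra k :=
  (μ.rowLens.map (hGen k)).prod

/-- The coefficient `M'_{μρ} = (h_μ, h_ρ)`. -/
def oddM' (k : Type*) [CommRing k] (μ ρ : YoungDiagram) : k :=
  oddForm k (hPart k μ) (hPart k ρ)

/-! ### Matrices -/

/-- The natural number matrices `A` with `row(A) = μ` and `col(A) = ρ`. -/
abbrev NMatrix (μ ρ : YoungDiagram) : Type :=
  {A : Matrix (Fin (μ.colLen 0)) (Fin (ρ.colLen 0)) ℕ //
    (∀ i, ∑ j, A i j = μ.rowLen i) ∧ ∀ j, ∑ i, A i j = ρ.rowLen j}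

/-- The sign of a matrix: a factor `(-1)^{ab}` for every pair of entries in which `a` is strictly
below and strictly to the left of `b`. -/
def matrixSign {r s : ℕ} (A : Matrix (Fin r) (Fin s) ℕ) : ℤ :=
  ∏ i, ∏ j, ∏ i', ∏ j', if i' < i ∧ j < j' then (-1) ^ (A i j * A i' j') else 1

/-! ### Tableaux -/

/-- The list of rows of a tableau, from top to bottom, each read from left to right. -/
def rows {lam : YoungDiagram} (T : SemistandardYoungTableau lam) : List (List ℕ) :=
  (List.range (lam.colLen 0)).map fun i => (List.range (lam.rowLen i)).map fun j => T i j

/-- The row word: the entries read from left to right, bottom to top. -/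
def rowWord {lam : YoungDiagram} (T : SemistandardYoungTableau lam) : List ℕ :=
  (rows T).reverse.flatten

/-- The sign of a word: the sign `(-1)^ℓ` of a minimal length permutation, of length `ℓ`, which
sorts the word into non-decreasing order. -/
def wordSign (w : List ℕ) : ℤ :=
  (-1) ^ sInf {l | ∃ σ : Equiv.Perm (Fin w.length),
    Monotone (fun i => w.get (σ i)) ∧ invCount σ = l}

/-- The sign of a tableau. -/
def tableauSign {lam : YoungDiagram} (T : SemistandardYoungTableau lam) : ℤ :=
  wordSign (rowWord T)

/-- `cont(T) = μ`: for every `k`, the `k`-th letter occurs exactly `μ_k` times in `T`. -/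
def HasContent {lam : YoungDiagram} (T : SemistandardYoungTableau lam) (μ : YoungDiagram) : Prop :=
  ∀ k, (lam.cells.filter fun c => T c.1 c.2 = k).card = μ.rowLen k

/-- There are finitely many semistandard tableaux of given shape and content. -/
instance finite_hasContent (lam μ : YoungDiagram) :
    Finite {T : SemistandardYoungTableau lam // HasContent T μ} := by
  have hlt : ∀ T : {T : SemistandardYoungTableau lam // HasContent T μ}, ∀ c : lam.cells,
      T.1 c.1.1 c.1.2 < μ.colLen 0 := by
    intro T c
    rw [← YoungDiagram.mem_iff_lt_colLen, YoungDiagram.mem_iff_lt_rowLen, ← T.2]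
    exact Finset.card_pos.mpr ⟨c.1, by simp⟩
  refine Finite.of_injective
    (fun T (c : lam.cells) => (⟨T.1 c.1.1 c.1.2, hlt T c⟩ : Fin (μ.colLen 0))) ?_
  intro T T' h
  apply Subtype.ext
  ext i j
  by_cases hc : (i, j) ∈ lam
  · have := congrFun h ⟨(i, j), (YoungDiagram.mem_cells _).mpr hc⟩
    simpa using this
  · rw [T.1.zeros hc, T'.1.zeros hc]

/-- The odd Kostka number `K_{λμ} = sign(T_λ) ∑_T sign(T)`, the sum over the semistandard tableaux
`T` of shape `λ` and content `μ`; here `T_λ` is the tableau of shape and content `λ`, whose `i`-th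
row consists of the `i`-th letter only. -/
def oddKostka (lam μ : YoungDiagram) : ℤ :=
  tableauSign (SemistandardYoungTableau.highestWeight lam) *
    ∑ᶠ T : {T : SemistandardYoungTableau lam // HasContent T μ}, tableauSign T.1

/-- The pairs `(P, Q)` of semistandard tableaux of the same shape with `cont(P) = ρ` and
`cont(Q) = μ`. -/
abbrev TableauPair (ρ μ : YoungDiagram) : Type :=
  {T : (lam : YoungDiagram) × SemistandardYoungTableau lam × SemistandardYoungTableau lam //
    HasContent T.2.1 ρ ∧ HasContent T.2.2 μ}

/-- `⟨λ⟩ = ∑_i λ_i (λ_i + 1) / 2`. -/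
def ang (lam : YoungDiagram) : ℕ := (lam.rowLens.map fun a => a * (a + 1) / 2).sum

/-- `λ_2 + λ_4 + λ_6 + ⋯`. -/
def evenRowSum (lam : YoungDiagram) : ℕ :=
  ∑ i ∈ (Finset.range (lam.colLen 0)).filter (fun i => i % 2 = 1), lam.rowLen i

theorem finite_card_eq (n : ℕ) : {lam : YoungDiagram | lam.card = n}.Finite := by
  refine Set.Finite.of_injOn (f := YoungDiagram.cells)
    (t := ((Finset.range n ×ˢ Finset.range n).powerset : Finset (Finset (ℕ × ℕ)))) ?_ ?_
    (Finset.finite_toSet _)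
  · intro lam hlam
    simp only [Set.mem_ofPred_eq] at hlam
    simp only [Finset.coe_powerset, Set.mem_preimage, Set.mem_powerset_iff, Finset.coe_subset]
    rintro ⟨i, j⟩ h
    rw [YoungDiagram.mem_cells] at h
    have hi : i < lam.card := (YoungDiagram.mem_iff_lt_colLen.mp h).trans_le (by
      rw [YoungDiagram.colLen_eq_card]; exact Finset.card_le_card (Finset.filter_subset _ _))
    have hj : j < lam.card := (YoungDiagram.mem_iff_lt_rowLen.mp h).trans_le (by
      rw [YoungDiagram.rowLen_eq_card]; exact Finset.card_le_card (Finset.filter_subset _ _))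
    simp only [Finset.mem_product, Finset.mem_range]
    omega
  · intro a _ b _ h
    exact YoungDiagram.ext h

/-- The finite set of all partitions of `n`. -/
def partitionsOf (n : ℕ) : Finset YoungDiagram := (finite_card_eq n).toFinset

end

/-! ### The RSK map -/

/-- Insert `x` into a row: `x` replaces the leftmost entry greater than `x`, which is bumped, or is
put at the end of the row if there is none. -/
def rowInsert (x : ℕ) : List ℕ → List ℕ × Option ℕ
  | [] => ([x], none)
  | y :: ys =>
    if x < y then (x :: ys, some y) else (y :: (rowInsert x ys).1, (rowInsert x ys).2)

/-- Schensted's row insertion of `x` into the tableau with the given rows: a bumped entry is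
inserted into the next row.  Returns the new tableau and the index of the row in which the new box
appears. -/
def insertion : ℕ → List (List ℕ) → List (List ℕ) × ℕ
  | x, [] => ([[x]], 0)
  | x, r :: rs =>
    match rowInsert x r with
    | (r', none) => (r' :: rs, 0)
    | (r', some y) => (r' :: (insertion y rs).1, (insertion y rs).2 + 1)

/-- Add a box with entry `u` at the end of the row with index `i`. -/
def addBox (u : ℕ) : ℕ → List (List ℕ) → List (List ℕ)
  | _, [] => [[u]]
  | 0, r :: rs => (r ++ [u]) :: rs
  | i + 1, r :: rs => r :: addBox u i rs

/-- One step of the RSK algorithm, for the column `(u, v)` of the two-line array: `v` is inserted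
into `P`, and `u` is recorded in `Q` at the place of the new box. -/
def rskStep (PQ : List (List ℕ) × List (List ℕ)) (uv : ℕ × ℕ) :
    List (List ℕ) × List (List ℕ) :=
  ((insertion uv.2 PQ.1).1, addBox uv.1 (insertion uv.2 PQ.1).2 PQ.2)

/-- The two-line array of a matrix: the positions `(u, v) = (row, column)` of the entries, read from
left to right and top to bottom, an entry `a` contributing its position `a` times. -/
def twoLineArray {r s : ℕ} (A : Matrix (Fin r) (Fin s) ℕ) : List (ℕ × ℕ) :=
  (List.finRange r).flatMap fun i =>
    (List.finRange s).flatMap fun j => List.replicate (A i j) ((i : ℕ), (j : ℕ))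

/-- The RSK map: the lists of rows of the insertion tableau `P` and of the recording tableau `Q`
of a matrix. -/
def rsk {r s : ℕ} (A : Matrix (Fin r) (Fin s) ℕ) : List (List ℕ) × List (List ℕ) :=
  (twoLineArray A).foldl rskStep ([], [])

end OddRSK

namespace OddRSK

/-! ### Rows and tableaux as lists -/

/-! RSK is run on lexicographically sorted two-line arrays, with tableaux encoded as lists of rows.
Everything about the algorithm follows from an invariant `RSKInv`, preserved each time a column (u,
v) is appended.

Bijectivity is the classical argument. For equal u the letters v increase weakly, so the new boxes
move weakly upwards (`insertion_insertion_of_le`). The last box added is therefore the end of the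
topmost row of Q that contains its largest letter; removing it and reversing the bumps in P undoes
the step. The array recovered in this way is sorted because inserting a strictly smaller letter next
would end strictly lower (`insertion_insertion_of_lt`).

For the sign, let inv be the number of inversions of a word and let the new box appear in row i,
counted from 0. A bump in a row r changes the inversions of the word by |r| + 1 modulo 2, so
inserting v changes inv of (row word of P)v by N + i, where N is the number of boxes in the rows
above row i (`inv_insertion`). The letter u is larger than all entries of those rows and not smaller
than any other entry, so inv of the row word of Q grows by exactly N (`inv_addBox`). The two N
cancel modulo 2. What remains, the sum of the row indices of all boxes, has the parity both of λ_2 +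
λ_4 + ⋯ and of ⟨λ^T⟩ + |λ|. The sign of A is the parity of inv of the lower row of its array
(`matrixSign_eq`).

For the bilinear form, a permutation is sent to the matrix that counts positions by the block of the
argument and the block of the value. This identifies double cosets with matrices of prescribed
margins, and the minimal length in a coset is the number of inversions forced by the matrix
(`finsum_neg_one_pow_length`). So M' is the sum of sign(A), and RSK factors it shape by shape; the
factors sign(T_λ) occur twice and cancel. -/

/-- The row `s` may be placed below the row `r`: it is not longer, and every entry of `s` is
greater than the entry of `r` above it. -/
def Over : List ℕ → List ℕ → Prop
  | _, [] => True
  | [], _ :: _ => False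
  | a :: r, b :: s => a < b ∧ Over r s

/-- The list of rows of a semistandard tableau. -/
def IsTab : List (List ℕ) → Prop
  | [] => True
  | r :: rs => r ≠ [] ∧ r.Pairwise (· ≤ ·) ∧ Over r (rs.headD []) ∧ IsTab rs

/-- A list of numbers which decreases weakly. -/
def Dec : List ℕ → Prop
  | [] => True
  | a :: l => l.headD 0 ≤ a ∧ Dec l

/-- Add a cell at the end of the row with index `i` of a shape. -/
def addCell : ℕ → List ℕ → List ℕ
  | _, [] => [1]
  | 0, a :: l => (a + 1) :: l
  | i + 1, a :: l => a :: addCell i l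

@[simp] theorem over_nil (r : List ℕ) : Over r [] := by cases r <;> trivial

@[simp] theorem not_nil_over (b : ℕ) (s : List ℕ) : ¬ Over [] (b :: s) := id

@[simp] theorem over_cons_cons (a b : ℕ) (r s : List ℕ) :
    Over (a :: r) (b :: s) ↔ a < b ∧ Over r s := Iff.rfl

theorem Over.length_le : ∀ {r s : List ℕ}, Over r s → s.length ≤ r.length
  | _, [], _ => Nat.zero_le _
  | [], _ :: _, h => h.elim
  | _ :: _, _ :: _, h => Nat.succ_le_succ h.2.length_le

theorem Over.append_right (u : ℕ) : ∀ {r s : List ℕ}, Over r s → s.length < r.length →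
    (∀ a ∈ r, a < u) → Over r (s ++ [u])
  | [], _, _, h, _ => by simp at h
  | a :: r, [], _, _, h => ⟨h a (by simp), over_nil _⟩
  | a :: r, b :: s, h, hl, hu => ⟨h.1, h.2.append_right u (by simpa using hl)
      fun c hc => hu c (by simp [hc])⟩

theorem Over.of_append_right : ∀ {r s t : List ℕ}, Over r (s ++ t) → Over r s
  | _, [], _, _ => over_nil _
  | [], _ :: _, _, h => h.elim
  | _ :: _, _ :: _, _, h => ⟨h.1, h.2.of_append_right⟩

theorem Over.of_append_left : ∀ {r s t : List ℕ}, Over (r ++ t) s → s.length ≤ r.length → Over r s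
  | _, [], _, _, _ => over_nil _
  | [], _ :: _, _, _, h => by simp at h
  | _ :: _, _ :: _, _, h, hl => ⟨h.1, h.2.of_append_left (by simpa using hl)⟩

theorem Over.append_left : ∀ {r s : List ℕ} (t : List ℕ), Over r s → Over (r ++ t) s
  | _, [], _, _ => over_nil _
  | [], _ :: _, _, h => h.elim
  | _ :: _, _ :: _, _, h => ⟨h.1, h.2.append_left _⟩

/-! ### Row insertion -/

theorem rowInsert_cons_of_lt {x y : ℕ} (h : x < y) (ys : List ℕ) :
    rowInsert x (y :: ys) = (x :: ys, some y) := by simp [rowInsert, h]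

theorem rowInsert_cons_of_le {x y : ℕ} (h : y ≤ x) (ys : List ℕ) :
    rowInsert x (y :: ys) = (y :: (rowInsert x ys).1, (rowInsert x ys).2) := by
  simp [rowInsert, h.not_gt]

@[simp] theorem rowInsert_nil (x : ℕ) : rowInsert x [] = ([x], none) := rfl

theorem rowInsert_eq_none {x : ℕ} : ∀ {r r' : List ℕ}, rowInsert x r = (r', none) →
    r' = r ++ [x] ∧ ∀ a ∈ r, a ≤ x
  | [], r', h => by simp_all
  | c :: r, r', h => by
    rcases lt_or_ge x c with hc | hc
    · simp [rowInsert_cons_of_lt hc] at h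
    · rw [rowInsert_cons_of_le hc] at h
      simp only [Prod.mk.injEq] at h
      obtain ⟨h1, h2⟩ := rowInsert_eq_none (r := r) (Prod.ext rfl h.2)
      constructor
      · exact h.1.symm.trans (congrArg (c :: ·) h1)
      · simpa [hc] using h2

theorem rowInsert_eq_some {x y : ℕ} : ∀ {r r' : List ℕ}, rowInsert x r = (r', some y) →
    ∃ a b, r = a ++ y :: b ∧ r' = a ++ x :: b ∧ (∀ c ∈ a, c ≤ x) ∧ x < y
  | [], r', h => by simp_all
  | c :: r, r', h => by
    rcases lt_or_ge x c with hc | hc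
    · rw [rowInsert_cons_of_lt hc] at h
      simp only [Prod.mk.injEq, Option.some.injEq] at h
      exact ⟨[], r, by simp [h.2], by simp [h.1], by simp, h.2 ▸ hc⟩
    · rw [rowInsert_cons_of_le hc] at h
      simp only [Prod.mk.injEq] at h
      obtain ⟨a, b, h1, h2, h3, h4⟩ := rowInsert_eq_some (r := r) (Prod.ext rfl h.2)
      refine ⟨c :: a, b, by simp [h1], by simp [← h.1, h2], by simpa [hc] using h3, h4⟩

theorem rowInsert_of_forall_le {x : ℕ} : ∀ {r : List ℕ}, (∀ a ∈ r, a ≤ x) →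
    rowInsert x r = (r ++ [x], none)
  | [], _ => rfl
  | c :: r, h => by
    rw [rowInsert_cons_of_le (h c (by simp)),
      rowInsert_of_forall_le fun a ha => h a (by simp [ha])]
    rfl

theorem mem_rowInsert (x : ℕ) : ∀ r : List ℕ, x ∈ (rowInsert x r).1
  | [] => by simp
  | c :: r => by
    rcases lt_or_ge x c with hc | hc
    · simp [rowInsert_cons_of_lt hc]
    · simp [rowInsert_cons_of_le hc, mem_rowInsert x r]

theorem rowInsert_ne_nil (x : ℕ) (r : List ℕ) : (rowInsert x r).1 ≠ [] :=
  List.ne_nil_of_mem (mem_rowInsert x r)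

theorem mem_of_mem_rowInsert {x a : ℕ} {r : List ℕ} (h : a ∈ (rowInsert x r).1) :
    a = x ∨ a ∈ r := by
  rcases ho : rowInsert x r with ⟨r', _ | y⟩ <;> rw [ho] at h
  · rw [(rowInsert_eq_none ho).1] at h
    simp at h; tauto
  · obtain ⟨p, q, rfl, rfl, -, -⟩ := rowInsert_eq_some ho
    simp at h ⊢; tauto

theorem pairwise_rowInsert (x : ℕ) : ∀ {r : List ℕ}, r.Pairwise (· ≤ ·) →
    (rowInsert x r).1.Pairwise (· ≤ ·)
  | [], _ => by simp
  | c :: r, h => by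
    rw [List.pairwise_cons] at h
    rcases lt_or_ge x c with hc | hc
    · rw [rowInsert_cons_of_lt hc]
      exact List.pairwise_cons.2 ⟨fun a ha => hc.le.trans (h.1 a ha), h.2⟩
    · rw [rowInsert_cons_of_le hc]
      refine List.pairwise_cons.2 ⟨fun a ha => ?_, pairwise_rowInsert x h.2⟩
      rcases mem_of_mem_rowInsert ha with rfl | ha
      · exact hc
      · exact h.1 a ha

theorem Over.rowInsert_left (x : ℕ) : ∀ {r s : List ℕ}, Over r s → Over (rowInsert x r).1 s
  | _, [], _ => over_nil _
  | [], _ :: _, h => h.elim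
  | c :: r, d :: s, h => by
    rcases lt_or_ge x c with hc | hc
    · rw [rowInsert_cons_of_lt hc]
      exact ⟨hc.trans h.1, h.2⟩
    · rw [rowInsert_cons_of_le hc]
      exact ⟨h.1, h.2.rowInsert_left x⟩

/-- The entry below `y`, if any, exceeds `y`, so `y` enters the next row weakly to the left of the
column it left. There the entry above it is at most `x`, hence smaller than `y`; in the column of
the bump the upper entry only decreases. -/
theorem Over.rowInsert_rowInsert {x y : ℕ} : ∀ {r r' s : List ℕ}, r.Pairwise (· ≤ ·) → Over r s →
    rowInsert x r = (r', some y) → Over r' (rowInsert y s).1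
  | [], _, _, _, _, h => by simp at h
  | c :: r, r', s, hr, hs, h => by
    rw [List.pairwise_cons] at hr
    rcases lt_or_ge x c with hc | hc
    · rw [rowInsert_cons_of_lt hc] at h
      simp only [Prod.mk.injEq, Option.some.injEq] at h
      obtain ⟨rfl, rfl⟩ := h
      cases s with
      | nil => simp [hc]
      | cons d s =>
        rw [rowInsert_cons_of_lt hs.1]
        exact ⟨hc, hs.2⟩
    · rw [rowInsert_cons_of_le hc] at h
      simp only [Prod.mk.injEq] at h
      obtain ⟨rfl, h⟩ := h
      obtain ⟨a, b, -, -, -, hxy⟩ := rowInsert_eq_some (r := r) (Prod.ext rfl h)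
      cases s with
      | nil => simp [hc.trans_lt hxy]
      | cons d s =>
        rcases lt_or_ge y d with hd | hd
        · rw [rowInsert_cons_of_lt hd]
          exact ⟨hc.trans_lt hxy, hs.2.rowInsert_left x⟩
        · rw [rowInsert_cons_of_le hd]
          exact ⟨hs.1, hs.2.rowInsert_rowInsert hr.2 (Prod.ext rfl h)⟩

/-- Row bumping lemma, weak case. Membership in the `Option` also records that the second insertion
can bump only if the first one did, which is what the induction over rows needs. -/
theorem rowInsert_rowInsert_of_le {x x' : ℕ} (hx : x ≤ x') : ∀ {r : List ℕ},
    r.Pairwise (· ≤ ·) → ∀ y' ∈ (rowInsert x' (rowInsert x r).1).2, ∃ y ∈ (rowInsert x r).2, y ≤ y'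
  | [], _, y', h => by simp [rowInsert, hx.not_gt] at h
  | c :: r, hr, y', h => by
    rw [List.pairwise_cons] at hr
    rcases lt_or_ge x c with hc | hc
    · rw [rowInsert_cons_of_lt hc] at h ⊢
      rw [rowInsert_cons_of_le hx] at h
      obtain ⟨a, b, rfl, -, -, -⟩ := rowInsert_eq_some (r := r) (Prod.ext rfl h)
      exact ⟨c, rfl, hr.1 y' (by simp)⟩
    · rw [rowInsert_cons_of_le hc] at h ⊢
      rw [rowInsert_cons_of_le (hc.trans hx)] at h
      exact rowInsert_rowInsert_of_le hx hr.2 y' h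

theorem rowInsert_rowInsert_of_lt {x x' : ℕ} (hx : x' < x) : ∀ (r : List ℕ),
    ∃ y' ∈ (rowInsert x' (rowInsert x r).1).2, ∀ y ∈ (rowInsert x r).2, y' < y
  | [] => ⟨x, by simp [rowInsert, hx]⟩
  | c :: r => by
    rcases lt_or_ge x c with hc | hc
    · rw [rowInsert_cons_of_lt hc, rowInsert_cons_of_lt hx]
      exact ⟨x, rfl, by simpa using hc⟩
    · rw [rowInsert_cons_of_le hc]
      rcases lt_or_ge x' c with hc' | hc'
      · rw [rowInsert_cons_of_lt hc']
        refine ⟨c, rfl, fun y hy => ?_⟩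
        obtain ⟨a, b, -, -, -, hxy⟩ := rowInsert_eq_some (r := r) (Prod.ext rfl hy)
        exact hc.trans_lt hxy
      · rw [rowInsert_cons_of_le hc']
        exact rowInsert_rowInsert_of_lt hx r

/-- The bumped letter determines where the bump took place. If one bump were at the head and the
other further right, the letter inserted by the latter would lie in the tail of the first row, hence
be at least `y`, whereas it is smaller than the letter it bumps. -/
theorem rowInsert_injective {x x' y : ℕ} : ∀ {r s t : List ℕ}, r.Pairwise (· ≤ ·) →
    s.Pairwise (· ≤ ·) → rowInsert x r = (t, some y) → rowInsert x' s = (t, some y) →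
      x = x' ∧ r = s
  | [], _, _, _, _, h, _ => by simp at h
  | _, [], _, _, _, _, h => by simp at h
  | c :: r, d :: s, t, hr, hs, h, h' => by
    rw [List.pairwise_cons] at hr hs
    rcases lt_or_ge x c with hc | hc <;> rcases lt_or_ge x' d with hd | hd
    · rw [rowInsert_cons_of_lt hc] at h
      rw [rowInsert_cons_of_lt hd] at h'
      simp only [Prod.mk.injEq, Option.some.injEq] at h h'
      obtain ⟨rfl, rfl⟩ := h
      simp_all
    · rw [rowInsert_cons_of_lt hc] at h
      rw [rowInsert_cons_of_le hd] at h'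
      simp only [Prod.mk.injEq, Option.some.injEq] at h h'
      obtain ⟨rfl, rfl⟩ := h
      simp only [List.cons.injEq] at h'
      obtain ⟨a, b, -, -, -, hxy⟩ := rowInsert_eq_some (r := s) (Prod.ext rfl h'.2)
      have := hr.1 x' (h'.1.2 ▸ mem_rowInsert x' s)
      omega
    · rw [rowInsert_cons_of_le hc] at h
      rw [rowInsert_cons_of_lt hd] at h'
      simp only [Prod.mk.injEq, Option.some.injEq] at h h'
      obtain ⟨rfl, rfl⟩ := h'
      simp only [List.cons.injEq] at h
      obtain ⟨a, b, -, -, -, hxy⟩ := rowInsert_eq_some (r := r) (Prod.ext rfl h.2)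
      have := hs.1 x (h.1.2 ▸ mem_rowInsert x r)
      omega
    · rw [rowInsert_cons_of_le hc] at h
      rw [rowInsert_cons_of_le hd] at h'
      simp only [Prod.mk.injEq] at h h'
      obtain ⟨rfl, h⟩ := h
      simp only [List.cons.injEq] at h'
      obtain ⟨e1, e2⟩ := rowInsert_injective hr.2 hs.2 (Prod.ext rfl h) (Prod.ext h'.1.2 h'.2)
      exact ⟨e1, by rw [e2, h'.1.1]⟩

/-- Reverse bumping: `y` replaces the last entry smaller than `y`, which is ejected as `x`; `c < y`
ensures that there is one. The bounds by `c` only serve the induction. The last clause keeps columns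
strict when the insertion of `y` below is undone at the same time. -/
theorem exists_rowInsert_eq {y : ℕ} : ∀ {c : ℕ} {t : List ℕ}, (c :: t).Pairwise (· ≤ ·) → c < y →
    ∃ x r, rowInsert x r = (c :: t, some y) ∧ r.Pairwise (· ≤ ·) ∧ c ≤ x ∧
      (∀ z ∈ r, c ≤ z) ∧
      ∀ s : List ℕ, s.Pairwise (· ≤ ·) → Over (c :: t) (rowInsert y s).1 → Over r s
  | c, [], hp, hc => by
    refine ⟨c, [y], rowInsert_cons_of_lt hc _, by simp, le_rfl, by simpa using hc.le, ?_⟩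
    rintro (_ | ⟨e, s⟩) hs h
    · simp
    · rcases lt_or_ge y e with he | he
      · rw [rowInsert_cons_of_lt he] at h
        exact ⟨he, h.2⟩
      · rw [rowInsert_cons_of_le he] at h
        exact absurd (h.2.length_le.trans_eq List.length_nil)
          (List.length_pos_of_mem (mem_rowInsert y s)).not_ge
  | c, d :: t, hp, hc => by
    rw [List.pairwise_cons] at hp
    rcases lt_or_ge d y with hd | hd
    · obtain ⟨x, r, h1, h2, h3, h5, h4⟩ := exists_rowInsert_eq hp.2 hd
      have hcd := hp.1 d (by simp)
      have hr : ∀ z ∈ r, c ≤ z := fun z hz => hcd.trans (h5 z hz)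
      refine ⟨x, c :: r, ?_, List.pairwise_cons.2 ⟨hr, h2⟩, hcd.trans h3, ?_, ?_⟩
      · rw [rowInsert_cons_of_le (hcd.trans h3), h1]
      · simpa using hr
      · rintro (_ | ⟨e, s⟩) hs h
        · simp
        · rw [List.pairwise_cons] at hs
          rcases lt_or_ge y e with he | he
          · rw [rowInsert_cons_of_lt he] at h
            refine ⟨hc.trans he, h4 s hs.2 ?_⟩
            cases s with
            | nil => simpa using hd
            | cons f s =>
              rw [rowInsert_cons_of_lt (he.trans_le (hs.1 f (by simp)))]
              exact ⟨hd, h.2.2⟩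
          · rw [rowInsert_cons_of_le he] at h
            exact ⟨h.1, h4 s hs.2 h.2⟩
    · refine ⟨c, y :: d :: t, rowInsert_cons_of_lt hc _, ?_, le_rfl, ?_, ?_⟩
      · refine List.pairwise_cons.2 ⟨?_, hp.2⟩
        have := (List.pairwise_cons.1 hp.2).1
        simpa [hd] using fun a ha => hd.trans (this a ha)
      · simpa [hc.le] using hp.1
      · rintro (_ | ⟨e, s⟩) hs h
        · simp
        · rw [List.pairwise_cons] at hs
          rcases lt_or_ge y e with he | he
          · rw [rowInsert_cons_of_lt he] at h
            exact ⟨he, h.2⟩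
          · rw [rowInsert_cons_of_le he] at h
            exfalso
            -- If `y` had entered the lower row to the right of the head, the entry above it would
            -- be at least `y`, against strictness of columns.
            have hmem : ∀ {t s : List ℕ}, (∀ a ∈ t, y ≤ a) → Over t s → y ∈ s → False := by
              intro t
              induction t with
              | nil => rintro (_ | ⟨b, s⟩) _ h hy <;> simp at h hy
              | cons a t ih =>
                rintro (_ | ⟨b, s⟩) ha h hy
                · simp at hy
                · rcases List.mem_cons.1 hy with rfl | hy
                  · exact absurd h.1 (ha a (by simp)).not_gt
                  · exact ih (fun c hc => ha c (by simp [hc])) h.2 hy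
            refine hmem ?_ h.2 (mem_rowInsert y s)
            have := (List.pairwise_cons.1 hp.2).1
            simpa [hd] using fun a ha => hd.trans (this a ha)

/-! ### Schensted insertion -/

theorem insertion_cons_none {x : ℕ} {r r' : List ℕ} (h : rowInsert x r = (r', none))
    (rs : List (List ℕ)) : insertion x (r :: rs) = (r' :: rs, 0) := by
  simp [insertion, h]

theorem insertion_cons_some {x y : ℕ} {r r' : List ℕ} (h : rowInsert x r = (r', some y))
    (rs : List (List ℕ)) :
    insertion x (r :: rs) = (r' :: (insertion y rs).1, (insertion y rs).2 + 1) := by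
  simp [insertion, h]

@[simp] theorem insertion_nil (x : ℕ) : insertion x [] = ([[x]], 0) := rfl

theorem headD_insertion (x : ℕ) (P : List (List ℕ)) :
    (insertion x P).1.headD [] = (rowInsert x (P.headD [])).1 := by
  cases P with
  | nil => rfl
  | cons r rs =>
    rcases h : rowInsert x r with ⟨r', _ | y⟩
    · simp [insertion_cons_none h, h]
    · simp [insertion_cons_some h, h]

theorem IsTab.pairwise_headD {P : List (List ℕ)} (h : IsTab P) :
    (P.headD []).Pairwise (· ≤ ·) := by
  cases P with
  | nil => simp
  | cons r rs => exact h.2.1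

theorem IsTab.insertion (x : ℕ) {P : List (List ℕ)} (hP : IsTab P) :
    IsTab (insertion x P).1 := by
  induction P generalizing x with
  | nil => simp [IsTab]
  | cons r rs ih =>
    obtain ⟨-, h2, h3, h4⟩ := hP
    have hs := pairwise_rowInsert x h2
    have hne := rowInsert_ne_nil x r
    have ho := h3.rowInsert_left x
    rcases h : rowInsert x r with ⟨r', _ | y⟩
    · rw [insertion_cons_none h]
      rw [h] at hs hne ho
      exact ⟨hne, hs, ho, h4⟩
    · rw [insertion_cons_some h]
      rw [h] at hs hne
      refine ⟨hne, hs, ?_, ih y h4⟩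
      rw [headD_insertion]
      exact h3.rowInsert_rowInsert h2 h

theorem flatten_insertion_perm (x : ℕ) (P : List (List ℕ)) :
    (insertion x P).1.flatten.Perm (x :: P.flatten) := by
  induction P generalizing x with
  | nil => simp
  | cons r rs ih =>
    rcases h : rowInsert x r with ⟨r', _ | y⟩
    · rw [insertion_cons_none h, (rowInsert_eq_none h).1]
      simp
    · rw [insertion_cons_some h]
      obtain ⟨a, b, rfl, rfl, -, -⟩ := rowInsert_eq_some h
      simp only [List.flatten_cons]
      refine ((ih y).append_left _).trans ?_
      rw [← Multiset.coe_eq_coe]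
      simp only [← Multiset.cons_coe, ← Multiset.coe_add, List.append_assoc, List.cons_append]
      simp only [← Multiset.singleton_add]
      abel

theorem map_length_insertion (x : ℕ) (P : List (List ℕ)) :
    (insertion x P).1.map List.length = addCell (insertion x P).2 (P.map List.length) := by
  induction P generalizing x with
  | nil => simp [addCell]
  | cons r rs ih =>
    rcases h : rowInsert x r with ⟨r', _ | y⟩
    · rw [insertion_cons_none h, (rowInsert_eq_none h).1]
      simp [addCell]
    · rw [insertion_cons_some h]
      obtain ⟨a, b, rfl, rfl, -, -⟩ := rowInsert_eq_some h
      simp [addCell, ih]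

theorem insertion_snd_le (x : ℕ) (P : List (List ℕ)) : (insertion x P).2 ≤ P.length := by
  induction P generalizing x with
  | nil => simp
  | cons r rs ih =>
    rcases h : rowInsert x r with ⟨r', _ | y⟩
    · simp [insertion_cons_none h]
    · simpa [insertion_cons_some h] using ih y

theorem insertion_insertion_of_le {x x' : ℕ} (hx : x ≤ x') {P : List (List ℕ)} (hP : IsTab P) :
    (insertion x' (insertion x P).1).2 ≤ (insertion x P).2 := by
  induction P generalizing x x' with
  | nil => simp [insertion, rowInsert, hx.not_gt]
  | cons r rs ih =>
    have key := rowInsert_rowInsert_of_le hx hP.2.1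
    rcases h : rowInsert x r with ⟨r', o⟩
    rw [h] at key
    rcases h' : rowInsert x' r' with ⟨r'', _ | y'⟩
    · cases o with
      | none => rw [insertion_cons_none h, insertion_cons_none h']
      | some y => rw [insertion_cons_some h, insertion_cons_none h']; exact Nat.zero_le _
    · rw [h'] at key
      obtain ⟨y, hy, hyy⟩ := key y' rfl
      obtain rfl : o = some y := hy
      rw [insertion_cons_some h, insertion_cons_some h']
      exact Nat.succ_le_succ (ih hyy hP.2.2.2)

/-- The smaller letter bumps in every row that the first insertion visited, including the one where
it stopped, and the bumped letters stay strictly ordered. -/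
theorem insertion_insertion_of_lt {x x' : ℕ} (hx : x' < x) (P : List (List ℕ)) :
    (insertion x P).2 < (insertion x' (insertion x P).1).2 := by
  induction P generalizing x x' with
  | nil => simp [insertion, rowInsert, hx]
  | cons r rs ih =>
    obtain ⟨y', hy', key⟩ := rowInsert_rowInsert_of_lt hx r
    rcases h : rowInsert x r with ⟨r', o⟩
    rw [h] at key hy'
    rcases h' : rowInsert x' r' with ⟨r'', o'⟩
    obtain rfl : o' = some y' := by rw [h'] at hy'; exact hy'
    cases o with
    | none => rw [insertion_cons_none h, insertion_cons_some h']; exact Nat.succ_pos _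
    | some y =>
      rw [insertion_cons_some h, insertion_cons_some h']
      exact Nat.succ_lt_succ (ih (key y rfl))

/-- Equality of the row indices is essential: both bumping paths end in the same row. The letters
that entered the lower rows then agree by induction, and `rowInsert_injective` undoes the bump above
them. -/
theorem insertion_injective {x x' : ℕ} {P P' : List (List ℕ)} (hP : IsTab P) (hP' : IsTab P')
    (h : insertion x P = insertion x' P') : x = x' ∧ P = P' := by
  induction P generalizing x x' P' with
  | nil =>
    cases P' with
    | nil => simpa using h
    | cons s ss =>
      rcases hs : rowInsert x' s with ⟨s', _ | y'⟩
      · rw [insertion_cons_none hs, (rowInsert_eq_none hs).1] at h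
        have := hP'.1
        simp at h
        cases s <;> simp_all
      · simp [insertion_cons_some hs] at h
  | cons r rs ih =>
    rcases hr : rowInsert x r with ⟨r', _ | y⟩
    · rw [insertion_cons_none hr, (rowInsert_eq_none hr).1] at h
      cases P' with
      | nil =>
        have := hP.1
        simp at h
        cases r <;> simp_all
      | cons s ss =>
        rcases hs : rowInsert x' s with ⟨s', _ | y'⟩
        · rw [insertion_cons_none hs, (rowInsert_eq_none hs).1] at h
          simp only [Prod.mk.injEq, List.cons.injEq, and_true] at h
          obtain ⟨h1, rfl⟩ := h
          obtain ⟨rfl, h1⟩ := List.append_inj' h1 rfl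
          simpa using h1
        · simp [insertion_cons_some hs] at h
    · cases P' with
      | nil => simp [insertion_cons_some hr] at h
      | cons s ss =>
        rcases hs : rowInsert x' s with ⟨s', _ | y'⟩
        · simp [insertion_cons_none hs, insertion_cons_some hr] at h
        · rw [insertion_cons_some hr, insertion_cons_some hs] at h
          simp only [Prod.mk.injEq, List.cons.injEq, add_left_inj] at h
          obtain ⟨⟨rfl, h1⟩, h2⟩ := h
          obtain ⟨rfl, rfl⟩ := ih hP.2.2.2 hP'.2.2.2 (Prod.ext h1 h2)
          obtain ⟨rfl, rfl⟩ := rowInsert_injective hP.2.1 hP'.2.1 hr hs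
          exact ⟨rfl, rfl⟩

/-- The last entry of row `i` is removed and then bumped backwards through the rows above it. -/
theorem exists_insertion_eq {i : ℕ} {sh : List ℕ} {P : List (List ℕ)} (hP : IsTab P)
    (hsh : Dec sh) (hpos : ∀ a ∈ sh, 0 < a) (hi : i ≤ sh.length)
    (hPs : P.map List.length = addCell i sh) :
    ∃ v P', IsTab P' ∧ P'.map List.length = sh ∧ insertion v P' = (P, i) := by
  induction sh generalizing i P with
  | nil =>
    obtain rfl : i = 0 := by simpa using hi
    simp only [addCell, List.map_eq_singleton_iff, List.length_eq_one_iff] at hPs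
    obtain ⟨_, rfl, v, rfl⟩ := hPs
    exact ⟨v, [], trivial, rfl, rfl⟩
  | cons a sh ih =>
    cases i with
    | zero =>
      simp only [addCell, List.map_eq_cons_iff] at hPs
      obtain ⟨r, rs, rfl, hr, rfl⟩ := hPs
      rcases List.eq_nil_or_concat r with rfl | ⟨r, v, rfl⟩
      · simp at hr
      · simp only [List.concat_eq_append, List.length_append, List.length_cons, List.length_nil,
          zero_add, add_left_inj] at hr
        subst hr
        simp only [List.concat_eq_append] at hP ⊢
        obtain ⟨-, h2, h3, h4⟩ := hP
        rw [List.pairwise_append] at h2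
        refine ⟨v, r :: rs, ⟨?_, h2.1, ?_, h4⟩, rfl, ?_⟩
        · rintro rfl
          simp at hpos
        · refine h3.of_append_left ?_
          have := hsh.1
          cases rs with
          | nil => simp
          | cons s rs => simpa using this
        · rw [insertion_cons_none (rowInsert_of_forall_le fun a ha => h2.2.2 a ha v (by simp))]
    | succ i =>
      simp only [addCell, List.map_eq_cons_iff] at hPs
      obtain ⟨r', rs', rfl, hr, hPs⟩ := hPs
      obtain ⟨h1, h2, h3, h4⟩ := hP
      obtain ⟨y, rs, h5, rfl, h6⟩ := ih h4 hsh.2 (fun b hb => hpos b (by simp [hb]))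
        (by simpa using hi) hPs
      have e : rs' = (insertion y rs).1 := by rw [h6]
      rw [e, headD_insertion] at h3
      cases r' with
      | nil => exact absurd rfl h1
      | cons c t =>
        -- After the insertion the row below contains `y`, so its first entry is at most `y`, and
        -- `c` stands above that entry.
        have hc : c < y := by
          have hy := mem_rowInsert y (rs.headD [])
          rcases hd : (rowInsert y (rs.headD [])).1 with _ | ⟨d, u⟩
          · rw [hd] at hy
            simp at hy
          · rw [hd] at h3
            have hs := pairwise_rowInsert y h5.pairwise_headD
            rw [hd] at hs hy
            rcases List.mem_cons.1 hy with rfl | hy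
            · exact h3.1
            · exact h3.1.trans_le ((List.pairwise_cons.1 hs).1 y hy)
        obtain ⟨x, r, k1, k2, -, -, k3⟩ := exists_rowInsert_eq h2 hc
        obtain ⟨p, q, rfl, e2, -, -⟩ := rowInsert_eq_some k1
        refine ⟨x, (p ++ y :: q) :: rs, ⟨by simp, k2, k3 _ h5.pairwise_headD h3, h5⟩, ?_, ?_⟩
        · rw [e2] at hr
          simpa using hr
        · rw [insertion_cons_some k1, h6]

/-! ### Adding a box -/

theorem IsTab.ne_nil {P : List (List ℕ)} (h : IsTab P) : ∀ r ∈ P, r ≠ [] := by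
  induction P with
  | nil => simp
  | cons r rs ih => simpa using ⟨h.1, ih h.2.2.2⟩

theorem IsTab.pairwise {P : List (List ℕ)} (h : IsTab P) : ∀ r ∈ P, r.Pairwise (· ≤ ·) := by
  induction P with
  | nil => simp
  | cons r rs ih => simpa using ⟨h.2.1, ih h.2.2.2⟩

theorem IsTab.dec {P : List (List ℕ)} (h : IsTab P) : Dec (P.map List.length) := by
  induction P with
  | nil => trivial
  | cons r rs ih =>
    refine ⟨?_, ih h.2.2.2⟩
    have := h.2.2.1.length_le
    cases rs with
    | nil => simp
    | cons s rs => simpa using this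

theorem map_length_addBox (u i : ℕ) (Q : List (List ℕ)) :
    (addBox u i Q).map List.length = addCell i (Q.map List.length) := by
  induction Q generalizing i with
  | nil => simp [addBox, addCell]
  | cons r rs ih => cases i <;> simp [addBox, addCell, ih]

theorem flatten_addBox_perm (u i : ℕ) (Q : List (List ℕ)) :
    (addBox u i Q).flatten.Perm (u :: Q.flatten) := by
  induction Q generalizing i with
  | nil => simp [addBox]
  | cons r rs ih =>
    cases i with
    | zero => simp [addBox]
    | succ i =>
      simp only [addBox, List.flatten_cons]
      exact ((ih i).append_left r).trans List.perm_middle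

theorem headD_addBox_succ (u i : ℕ) {Q : List (List ℕ)} (h : i + 1 ≤ Q.length) :
    (addBox u (i + 1) Q).headD [] = Q.headD [] := by
  cases Q with
  | nil => simp at h
  | cons r rs => rfl

theorem headD_addBox_zero (u : ℕ) (Q : List (List ℕ)) :
    (addBox u 0 Q).headD [] = Q.headD [] ++ [u] := by
  cases Q <;> rfl

/-- Rows stay weakly increasing because `u` is an upper bound. The new column entry is strictly
larger than the one above it because `u` does not occur in the rows above. -/
theorem IsTab.addBox {u i : ℕ} {Q : List (List ℕ)} (hQ : IsTab Q) (hu : ∀ r ∈ Q, ∀ a ∈ r, a ≤ u)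
    (hi : i ≤ Q.length) (hd : Dec (addCell i (Q.map List.length))) (ht : ∀ r ∈ Q.take i, u ∉ r) :
    IsTab (addBox u i Q) := by
  induction Q generalizing i with
  | nil => simp [OddRSK.addBox, IsTab]
  | cons r rs ih =>
    obtain ⟨h1, h2, h3, h4⟩ := hQ
    cases i with
    | zero =>
      refine ⟨by simp, List.pairwise_append.2 ⟨h2, by simp, ?_⟩, h3.append_left _, h4⟩
      simpa using hu r (by simp)
    | succ i =>
      refine ⟨h1, h2, ?_, ih h4 (fun s hs => hu s (by simp [hs])) (by simpa using hi) hd.2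
        fun s hs => ht s (by simp [hs])⟩
      cases i with
      | zero =>
        rw [headD_addBox_zero]
        refine h3.append_right u ?_ fun a ha => lt_of_le_of_ne (hu r (by simp) a ha) ?_
        · have := hd.1
          cases rs with
          | nil => simpa using List.length_pos_iff.2 h1
          | cons s rs => simpa [addCell] using this
        · rintro rfl
          exact ht r (by simp) ha
      | succ i => rwa [headD_addBox_succ u i (by simpa using hi)]

/-- The box to remove is the end of the topmost row containing the maximal letter `u`. -/
theorem exists_addBox_eq {u : ℕ} {Q : List (List ℕ)} (hQ : IsTab Q)
    (hu : ∀ r ∈ Q, ∀ a ∈ r, a ≤ u) (hm : ∃ r ∈ Q, u ∈ r) :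
    ∃ i Q', IsTab Q' ∧ addBox u i Q' = Q ∧ i ≤ Q'.length ∧ ∀ r ∈ Q'.take i, u ∉ r := by
  induction Q with
  | nil => simp at hm
  | cons r rs ih =>
    obtain ⟨h1, h2, h3, h4⟩ := hQ
    by_cases hr : u ∈ r
    · rcases List.eq_nil_or_concat r with rfl | ⟨r, v, rfl⟩
      · simp at hr
      simp only [List.concat_eq_append] at *
      rw [List.pairwise_append] at h2
      have hv : v ≤ u := hu (r ++ [v]) (by simp) v (by simp)
      obtain rfl : u = v := by
        rcases List.mem_append.1 hr with hr | hr
        · exact le_antisymm (h2.2.2 u hr v (by simp)) hv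
        · simpa using hr
      -- The box is a corner: an entry below it would have to exceed the maximum `u`.
      have hlen : (rs.headD []).length ≤ r.length := by
        have hall : ∀ b ∈ rs.headD [], b ≤ u := by
          cases rs with
          | nil => simp
          | cons s rs => exact hu s (by simp)
        generalize rs.headD [] = s at h3 hall
        clear h2 hu hm hr h1
        induction r generalizing s with
        | nil =>
          cases s with
          | nil => simp
          | cons b s => exact absurd h3.1 (hall b (by simp)).not_gt
        | cons a r ihr =>
          cases s with
          | nil => simp
          | cons b s => exact Nat.succ_le_succ (ihr s h3.2 fun c hc => hall c (by simp [hc]))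
      cases r with
      | nil =>
        cases rs with
        | nil => exact ⟨0, [], trivial, rfl, le_rfl, by simp⟩
        | cons s rs =>
          have := h4.1
          simp at hlen
          exact absurd hlen this
      | cons a r =>
        exact ⟨0, (a :: r) :: rs, ⟨by simp, h2.1, h3.of_append_left hlen, h4⟩, rfl,
          Nat.zero_le _, by simp⟩
    · obtain ⟨i, Q', k1, rfl, k2, k3⟩ := ih h4 (fun s hs => hu s (by simp [hs])) (by
        obtain ⟨s, hs, hus⟩ := hm
        rcases List.mem_cons.1 hs with rfl | hs
        · exact absurd hus hr
        · exact ⟨s, hs, hus⟩)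
      refine ⟨i + 1, r :: Q', ⟨h1, h2, ?_, k1⟩, rfl, Nat.succ_le_succ k2, ?_⟩
      · cases i with
        | zero =>
          rw [headD_addBox_zero] at h3
          exact h3.of_append_right
        | succ i => rwa [headD_addBox_succ u i k2] at h3
      · simpa using ⟨hr, k3⟩

theorem addBox_injective {u i j : ℕ} {Q Q' : List (List ℕ)} (hQ : IsTab Q) (hQ' : IsTab Q')
    (hi : i ≤ Q.length) (hj : j ≤ Q'.length) (ht : ∀ r ∈ Q.take i, u ∉ r)
    (ht' : ∀ r ∈ Q'.take j, u ∉ r) (h : addBox u i Q = addBox u j Q') : i = j ∧ Q = Q' := by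
  induction Q generalizing i j Q' with
  | nil =>
    obtain rfl : i = 0 := by simpa using hi
    cases Q' with
    | nil => exact ⟨(Nat.le_zero.1 hj).symm, rfl⟩
    | cons s ss =>
      cases j with
      | zero =>
        have := hQ'.1
        simp only [addBox, List.cons.injEq] at h
        cases s <;> simp_all
      | succ j =>
        simp only [addBox, List.cons.injEq] at h
        exact absurd (by simp [← h.1]) (ht' s (by simp))
  | cons r rs ih =>
    cases Q' with
    | nil =>
      obtain rfl : j = 0 := by simpa using hj
      cases i with
      | zero =>
        have := hQ.1
        simp only [addBox, List.cons.injEq] at h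
        cases r <;> simp_all
      | succ j =>
        simp only [addBox, List.cons.injEq] at h
        exact absurd (by simp [h.1]) (ht r (by simp))
    | cons s ss =>
      cases i <;> cases j <;> simp only [addBox, List.cons.injEq] at h
      · simpa using h
      · exact absurd (by simp [← h.1]) (ht' s (by simp))
      · exact absurd (by simp [h.1]) (ht r (by simp))
      · obtain ⟨rfl, rfl⟩ := ih hQ.2.2.2 hQ'.2.2.2 (by simpa using hi) (by simpa using hj)
          (fun a ha => ht a (by simp [ha])) (fun a ha => ht' a (by simp [ha])) h.2
        exact ⟨rfl, by rw [h.1]⟩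

theorem exists_mem_take_addBox {u i j : ℕ} {Q : List (List ℕ)} (hi : i ≤ Q.length) (hij : i < j) :
    ∃ r ∈ (addBox u i Q).take j, u ∈ r := by
  obtain ⟨j, rfl⟩ : ∃ k, j = k + 1 := ⟨j - 1, by omega⟩
  induction Q generalizing i j with
  | nil => simp [addBox]
  | cons r rs ih =>
    cases i with
    | zero => simp [addBox]
    | succ i =>
      obtain ⟨j, rfl⟩ : ∃ k, j = k + 1 := ⟨j - 1, by omega⟩
      obtain ⟨s, hs, hus⟩ := ih (by simpa using hi) j (Nat.lt_of_succ_lt_succ hij)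
      exact ⟨s, by simp only [addBox, List.take_succ_cons, List.mem_cons] at hs ⊢; tauto, hus⟩

theorem take_addBox {u i j : ℕ} {Q : List (List ℕ)} (hi : i ≤ Q.length) (hij : j ≤ i) :
    (addBox u i Q).take j = Q.take j := by
  induction Q generalizing i j with
  | nil =>
    obtain rfl : i = 0 := by simpa using hi
    obtain rfl : j = 0 := by simpa using hij
    simp
  | cons r rs ih =>
    cases j with
    | zero => simp
    | succ j =>
      obtain ⟨i, rfl⟩ : ∃ k, i = k + 1 := ⟨i - 1, by omega⟩
      simp [addBox, ih (Nat.le_of_succ_le_succ hi) (Nat.le_of_succ_le_succ hij)]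

/-! ### Inversions of words -/

/-- The number of inversions of a word. -/
def inv : List ℕ → ℕ
  | [] => 0
  | a :: l => l.countP (· < a) + inv l

/-- The number of pairs which consist of an entry of `l` and a smaller entry of `m`. -/
def cross (l m : List ℕ) : ℕ := (l.map fun a => m.countP (· < a)).sum

@[simp] theorem inv_nil : inv [] = 0 := rfl

@[simp] theorem inv_cons (a : ℕ) (l : List ℕ) : inv (a :: l) = l.countP (· < a) + inv l := rfl

@[simp] theorem cross_nil_left (m : List ℕ) : cross [] m = 0 := rfl

@[simp] theorem cross_cons_left (a : ℕ) (l m : List ℕ) :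
    cross (a :: l) m = m.countP (· < a) + cross l m := rfl

theorem cross_append_left (l l' m : List ℕ) : cross (l ++ l') m = cross l m + cross l' m := by
  simp [cross]

theorem cross_append_right (l m m' : List ℕ) : cross l (m ++ m') = cross l m + cross l m' := by
  induction l with
  | nil => rfl
  | cons a l ih => simp [ih]; omega

theorem inv_append (l m : List ℕ) : inv (l ++ m) = inv l + cross l m + inv m := by
  induction l with
  | nil => simp
  | cons a l ih => simp [ih]; omega

theorem cross_perm_left {l l' : List ℕ} (h : l.Perm l') (m : List ℕ) : cross l m = cross l' m :=
  (h.map _).sum_eq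

theorem cross_perm_right (l : List ℕ) {m m' : List ℕ} (h : m.Perm m') :
    cross l m = cross l m' := by
  simp [cross, h.countP_eq]

theorem inv_eq_zero {l : List ℕ} (h : l.Pairwise (· ≤ ·)) : inv l = 0 := by
  induction l with
  | nil => rfl
  | cons a l ih =>
    rw [List.pairwise_cons] at h
    simpa [ih h.2, List.countP_eq_zero] using h.1

theorem cross_eq_zero {l m : List ℕ} (h : ∀ a ∈ l, ∀ b ∈ m, a ≤ b) : cross l m = 0 := by
  induction l with
  | nil => rfl
  | cons a l ih =>
    simp only [cross_cons_left, ih fun c hc => h c (by simp [hc]), add_zero, List.countP_eq_zero]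
    simpa using h a (by simp)

/-! ### Row words, and the change of their inversions in one RSK step. -/

/-- The row word of a tableau given by its rows. -/
def rowsWord (P : List (List ℕ)) : List ℕ := P.reverse.flatten

@[simp] theorem rowsWord_nil : rowsWord [] = [] := rfl

@[simp] theorem rowsWord_cons (r : List ℕ) (P : List (List ℕ)) :
    rowsWord (r :: P) = rowsWord P ++ r := by simp [rowsWord]

theorem rowsWord_perm (P : List (List ℕ)) : (rowsWord P).Perm P.flatten :=
  (List.reverse_perm P).flatten

/-- Write r = a y b and r' = a x b. The word y r' has |a| + 1 inversions and r x has |b| + 1, and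
these numbers add up to |r| + 1. -/
theorem inv_rowInsert {x y : ℕ} {r r' : List ℕ} (hr : r.Pairwise (· ≤ ·))
    (h : rowInsert x r = (r', some y)) :
    (r'.countP (· < y) + r.length + 1) % 2 = inv (r ++ [x]) % 2 := by
  have hr' := pairwise_rowInsert x hr
  rw [h] at hr'
  rw [inv_append, inv_eq_zero hr]
  obtain ⟨a, b, rfl, rfl, h1, h2⟩ := rowInsert_eq_some h
  rw [List.pairwise_append, List.pairwise_cons] at hr
  have e1 : a.countP (· < y) = a.length := by
    rw [List.countP_eq_length]
    simpa using fun c hc => (h1 c hc).trans_lt h2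
  have e2 : b.countP (· < y) = 0 := by
    rw [List.countP_eq_zero]
    simpa using hr.2.1.1
  have e3 : cross a [x] = 0 := cross_eq_zero (by simpa using h1)
  have e4 : cross b [x] = b.length := by
    have : ∀ c ∈ b, x < c := fun c hc => h2.trans_le (hr.2.1.1 c hc)
    clear hr hr' e2 h
    induction b with
    | nil => rfl
    | cons c b ih =>
      rw [cross_cons_left, ih fun d hd => this d (by simp [hd])]
      simp [this c (by simp)]
      omega
  rw [cross_append_left, cross_cons_left, e3, e4]
  simp [e1, e2, h2]
  omega

/-- Let w be the row word of the lower rows. A bump turns w r x into w y r' at the cost |r| + 1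
modulo 2, and the recursion goes on with w y. Inversions between different parts of a word depend
only on the letters of each part, so nothing else changes. -/
theorem inv_insertion (x : ℕ) {P : List (List ℕ)} (hP : IsTab P) :
    (inv (rowsWord (insertion x P).1) + (P.take (insertion x P).2).flatten.length +
      (insertion x P).2) % 2 = inv (rowsWord P ++ [x]) % 2 := by
  induction P generalizing x with
  | nil => simp
  | cons r rs ih =>
    rcases h : rowInsert x r with ⟨r', _ | y⟩
    · rw [insertion_cons_none h, (rowInsert_eq_none h).1]
      simp
    · rw [insertion_cons_some h]
      have h1 := ih y hP.2.2.2
      have h2 := inv_rowInsert hP.2.1 h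
      have hs := pairwise_rowInsert x hP.2.1
      rw [h] at hs
      have h3 : cross (rowsWord (insertion y rs).1) r' = cross (y :: rowsWord rs) r' :=
        cross_perm_left ((rowsWord_perm _).trans
          ((flatten_insertion_perm y rs).trans ((rowsWord_perm rs).symm.cons y))) _
      have h4 : cross (rowsWord rs) (r ++ [x]) = cross (rowsWord rs) ([y] ++ r') := by
        refine cross_perm_right _ ?_
        obtain ⟨a, b, rfl, rfl, -, -⟩ := rowInsert_eq_some h
        rw [← Multiset.coe_eq_coe]
        simp only [← Multiset.cons_coe, ← Multiset.coe_add, List.append_assoc, List.cons_append,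
          List.nil_append, ← Multiset.singleton_add, Multiset.coe_nil, add_zero]
        abel
      rw [cross_append_right _ [y]] at h4
      rw [cross_cons_left] at h3
      rw [inv_append, inv_cons, inv_nil] at h1
      simp only [rowsWord_cons, List.append_assoc, inv_append (rowsWord _), h3, h4, inv_eq_zero hs,
        List.take_succ_cons, List.flatten_cons, List.length_append]
      simp only [List.countP_nil] at h1
      omega

/-- The rows above row `i` come later in the row word and all their entries are smaller than `u`; no
other letter forms an inversion with the new one. -/
theorem inv_addBox {u i : ℕ} {Q : List (List ℕ)} (hu : ∀ r ∈ Q, ∀ a ∈ r, a ≤ u)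
    (hi : i ≤ Q.length) (ht : ∀ r ∈ Q.take i, u ∉ r) :
    inv (rowsWord (addBox u i Q)) = inv (rowsWord Q) + (Q.take i).flatten.length := by
  induction Q generalizing i with
  | nil => simp [addBox]
  | cons r rs ih =>
    cases i with
    | zero =>
      rw [addBox, rowsWord_cons, ← List.append_assoc, inv_append, ← rowsWord_cons, cross_eq_zero]
      · simp
      · intro a ha b hb
        obtain ⟨s, hs, has⟩ := List.mem_flatten.1 ((rowsWord_perm _).mem_iff.1 ha)
        rw [List.mem_singleton.1 hb]
        exact hu s hs a has
    | succ i =>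
      have h1 := ih (fun s hs => hu s (by simp [hs])) (by simpa using hi)
        fun s hs => ht s (by simp [hs])
      have h2 : cross (rowsWord (addBox u i rs)) r = cross (u :: rowsWord rs) r :=
        cross_perm_left ((rowsWord_perm _).trans
          ((flatten_addBox_perm u i rs).trans ((rowsWord_perm rs).symm.cons u))) _
      have h3 : r.countP (· < u) = r.length := by
        rw [List.countP_eq_length]
        intro a ha
        have : a ≠ u := fun e => ht r (by simp) (e ▸ ha)
        simpa using lt_of_le_of_ne (hu r (by simp) a ha) this
      rw [addBox, rowsWord_cons, inv_append, h1, h2, cross_cons_left, h3, rowsWord_cons,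
        inv_append]
      simp
      omega

/-! ### The RSK algorithm on two-line arrays -/

/-- The lexicographic order of the columns of two-line arrays. -/
def LexLE (p q : ℕ × ℕ) : Prop := p.1 < q.1 ∨ p.1 = q.1 ∧ p.2 ≤ q.2

theorem LexLE.trans {p q r : ℕ × ℕ} (h : LexLE p q) (h' : LexLE q r) : LexLE p r := by
  unfold LexLE at *; omega

theorem LexLE.antisymm {p q : ℕ × ℕ} (h : LexLE p q) (h' : LexLE q p) : p = q := by
  unfold LexLE at *; ext <;> omega

/-- The sum of the row indices of the cells of a shape. -/
def rowWeight : List ℕ → ℕ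
  | [] => 0
  | _ :: l => l.sum + rowWeight l

theorem sum_addCell (i : ℕ) (sh : List ℕ) : (addCell i sh).sum = sh.sum + 1 := by
  induction sh generalizing i with
  | nil => simp [addCell]
  | cons a sh ih => cases i <;> simp [addCell, ih] <;> omega

theorem rowWeight_addCell {i : ℕ} {sh : List ℕ} (h : i ≤ sh.length) :
    rowWeight (addCell i sh) = rowWeight sh + i := by
  induction sh generalizing i with
  | nil =>
    obtain rfl : i = 0 := by simpa using h
    simp [addCell, rowWeight]
  | cons a sh ih =>
    cases i with
    | zero => simp [addCell, rowWeight]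
    | succ i =>
      simp [addCell, rowWeight, sum_addCell, ih (Nat.le_of_succ_le_succ h)]
      omega

/-- The properties of the pair of tableaux which RSK produces from a sorted two-line array. -/
structure RSKInv (L : List (ℕ × ℕ)) (PQ : List (List ℕ) × List (List ℕ)) : Prop where
  tabP : IsTab PQ.1
  tabQ : IsTab PQ.2
  shape : PQ.1.map List.length = PQ.2.map List.length
  permP : PQ.1.flatten.Perm (L.map Prod.snd)
  permQ : PQ.2.flatten.Perm (L.map Prod.fst)
  sign : (inv (rowsWord PQ.1) + inv (rowsWord PQ.2) + rowWeight (PQ.1.map List.length)) % 2 =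
    inv (L.map Prod.snd) % 2
  -- This looks one step ahead: whichever admissible column comes next, its letter `u` is absent
  -- from the rows above its box.
  notMem : ∀ u v, (∀ p ∈ L, LexLE p (u, v)) → ∀ r ∈ PQ.2.take (insertion v PQ.1).2, u ∉ r

theorem RSKInv.step {L : List (ℕ × ℕ)} {P Q : List (List ℕ)} (h : RSKInv L (P, Q)) {u v : ℕ}
    (huv : ∀ p ∈ L, LexLE p (u, v)) : RSKInv (L ++ [(u, v)]) (rskStep (P, Q) (u, v)) := by
  obtain ⟨hP, hQ, hsh, hpP, hpQ, hsg, hnm⟩ := h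
  simp only at hP hQ hsh hpP hpQ hsg hnm
  have hlen : P.length = Q.length := by simpa using congrArg List.length hsh
  have hi : (insertion v P).2 ≤ Q.length := hlen ▸ insertion_snd_le v P
  have hQu : ∀ r ∈ Q, ∀ a ∈ r, a ≤ u := by
    intro r hr a ha
    obtain ⟨p, hp, rfl⟩ := List.mem_map.1 (hpQ.mem_iff.1 (List.mem_flatten.2 ⟨r, hr, ha⟩))
    have := huv p hp
    unfold LexLE at this
    omega
  refine ⟨hP.insertion v, hQ.addBox hQu hi ?_ (hnm u v huv), ?_, ?_, ?_, ?_, ?_⟩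
  · rw [← hsh, ← map_length_insertion]
    exact (hP.insertion v).dec
  · simp [rskStep, map_length_addBox, map_length_insertion, hsh]
  · simp only [rskStep, List.map_append, List.map_cons, List.map_nil]
    exact (flatten_insertion_perm v P).trans
      ((hpP.cons v).trans (List.perm_append_singleton _ _).symm)
  · simp only [rskStep, List.map_append, List.map_cons, List.map_nil]
    exact (flatten_addBox_perm u _ Q).trans
      ((hpQ.cons u).trans (List.perm_append_singleton _ _).symm)
  · have h1 := inv_insertion v hP
    have h2 := inv_addBox hQu hi (hnm u v huv)
    have h3 := rowWeight_addCell (i := (insertion v P).2) (sh := P.map List.length)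
      (by simpa using insertion_snd_le v P)
    have h4 : cross (rowsWord P) [v] = cross (L.map Prod.snd) [v] :=
      cross_perm_left ((rowsWord_perm P).trans hpP) _
    have h5 : (P.take (insertion v P).2).flatten.length =
        (Q.take (insertion v P).2).flatten.length := by
      simp only [List.length_flatten, List.map_take, hsh]
    simp only [rskStep, map_length_insertion, h2, h3, List.map_append, List.map_cons, List.map_nil]
    rw [inv_append, h4] at h1
    rw [inv_append]
    omega
  -- A new larger letter does not occur in Q at all. For the same letter, the next box is no lower
  -- than the present one, so the rows above it are not affected by the present step.
  · intro u' v' h'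
    have huv' := h' (u, v) (by simp)
    rcases huv' with h1 | ⟨h1, h2⟩
    · intro r hr hu'
      have : u' ∈ (addBox u (insertion v P).2 Q).flatten :=
        List.mem_flatten.2 ⟨r, List.mem_of_mem_take hr, hu'⟩
      rw [(flatten_addBox_perm u _ Q).mem_iff, List.mem_cons, List.mem_flatten] at this
      rcases this with e | ⟨s, hs, hu's⟩
      · exact h1.ne' e
      · exact h1.not_ge (hQu s hs _ hu's)
    · simp only at h1 h2
      subst h1
      have hle := insertion_insertion_of_le h2 hP
      simp only [rskStep]
      rw [take_addBox hi hle]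
      intro r hr
      exact hnm u v huv r (List.take_subset_take_left _ hle hr)

theorem rskInv_foldl {L : List (ℕ × ℕ)} (hL : L.Pairwise LexLE) :
    RSKInv L (L.foldl rskStep ([], [])) := by
  induction L using List.reverseRecOn with
  | nil => exact ⟨trivial, trivial, rfl, by simp, by simp, by simp [rowWeight], by simp⟩
  | append_singleton L p ih =>
    rw [List.pairwise_append] at hL
    rw [List.foldl_append]
    exact (ih hL.1).step fun q hq => hL.2.2 q hq p (by simp)

/-- The last upper letter is the maximum of Q, so it is the same for both arrays. The last step is
then undone in Q, which gives the row of the box, and next in P. -/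
theorem foldl_rskStep_injective {L L' : List (ℕ × ℕ)} (hL : L.Pairwise LexLE)
    (hL' : L'.Pairwise LexLE) (h : L.foldl rskStep ([], []) = L'.foldl rskStep ([], [])) :
    L = L' := by
  induction L using List.reverseRecOn generalizing L' with
  | nil =>
    have := (rskInv_foldl hL').permP
    rw [← h] at this
    simpa using this.length_eq.symm
  | append_singleton L p ih =>
    rcases List.eq_nil_or_concat L' with rfl | ⟨L', p', rfl⟩
    · have := (rskInv_foldl hL).permP
      rw [h] at this
      simpa using this.length_eq
    simp only [List.concat_eq_append] at *
    have hQ1 := (rskInv_foldl hL).permQ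
    have hQ2 := (rskInv_foldl hL').permQ
    rw [← h] at hQ2
    have hm := hQ1.symm.trans hQ2
    rw [List.pairwise_append] at hL hL'
    have hle : ∀ q ∈ L, LexLE q p := fun q hq => hL.2.2 q hq p (by simp)
    have hle' : ∀ q ∈ L', LexLE q p' := fun q hq => hL'.2.2 q hq p' (by simp)
    obtain ⟨u, v⟩ := p
    obtain ⟨u', v'⟩ := p'
    obtain rfl : u = u' := by
      apply le_antisymm
      · obtain ⟨q, hq, e⟩ := List.mem_map.1 (hm.mem_iff.1 (by simp : u ∈ _))
        rcases List.mem_append.1 hq with hq | hq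
        · have := hle' q hq
          unfold LexLE at this
          simp only at this
          omega
        · simp at hq
          simp [← e, hq]
      · obtain ⟨q, hq, e⟩ := List.mem_map.1 (hm.mem_iff.2 (by simp : u' ∈ _))
        rcases List.mem_append.1 hq with hq | hq
        · have := hle q hq
          unfold LexLE at this
          simp only at this
          omega
        · simp at hq
          simp [← e, hq]
    have i1 := rskInv_foldl hL.1
    have i2 := rskInv_foldl hL'.1
    rw [List.foldl_append, List.foldl_append] at h
    have hii := @ih L' hL.1 hL'.1
    generalize L.foldl rskStep ([], []) = PQ at *
    generalize L'.foldl rskStep ([], []) = PQ' at *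
    obtain ⟨P, Q⟩ := PQ
    obtain ⟨P', Q'⟩ := PQ'
    simp only [List.foldl_cons, List.foldl_nil, rskStep, Prod.mk.injEq] at h
    have hlen : P.length = Q.length := by simpa using congrArg List.length i1.shape
    have hlen' : P'.length = Q'.length := by simpa using congrArg List.length i2.shape
    obtain ⟨e1, rfl⟩ := addBox_injective i1.tabQ i2.tabQ
      (hlen ▸ insertion_snd_le v P) (hlen' ▸ insertion_snd_le v' P') (i1.notMem u v hle)
      (i2.notMem u v' hle') h.2
    obtain ⟨rfl, rfl⟩ := insertion_injective i1.tabP i2.tabP (Prod.ext h.1 e1)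
    rw [hii rfl]

theorem exists_foldl_rskStep_eq {P Q : List (List ℕ)} (hP : IsTab P) (hQ : IsTab Q)
    (h : P.map List.length = Q.map List.length) :
    ∃ L : List (ℕ × ℕ), L.Pairwise LexLE ∧ L.foldl rskStep ([], []) = (P, Q) := by
  induction hn : Q.flatten.length generalizing P Q with
  | zero =>
    refine ⟨[], List.Pairwise.nil, ?_⟩
    have hQ0 : Q = [] := by
      cases Q with
      | nil => rfl
      | cons r rs =>
        simp only [List.flatten_cons, List.length_append, Nat.add_eq_zero_iff,
          List.length_eq_zero_iff] at hn
        exact absurd hn.1 hQ.1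
    subst hQ0
    simpa using h.symm
  | succ n ih =>
    obtain ⟨u, hu, humax⟩ : ∃ u ∈ Q.flatten, ∀ a ∈ Q.flatten, a ≤ u := by
      have hne : Q.flatten.toFinset.Nonempty := by
        rw [List.toFinset_nonempty_iff]
        rintro e
        simp [e] at hn
      refine ⟨_, List.mem_toFinset.1 (Finset.max'_mem _ hne), fun a ha => Finset.le_max' _ _ ?_⟩
      exact List.mem_toFinset.2 ha
    obtain ⟨i, Q', hQ', rfl, hi, ht⟩ := exists_addBox_eq hQ
      (fun r hr a ha => humax a (List.mem_flatten.2 ⟨r, hr, ha⟩)) (List.mem_flatten.1 hu)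
    rw [map_length_addBox] at h
    obtain ⟨v, P', hP', hsh, hins⟩ := exists_insertion_eq hP hQ'.dec (fun a ha => by
        obtain ⟨r, hr, rfl⟩ := List.mem_map.1 ha
        exact List.length_pos_iff.2 (hQ'.ne_nil r hr)) (by simpa using hi) h
    have hp := flatten_addBox_perm u i Q'
    obtain ⟨L, hL, hrun⟩ := ih hP' hQ' hsh (by simpa [hp.length_eq] using hn)
    refine ⟨L ++ [(u, v)], ?_, ?_⟩
    · refine List.pairwise_append.2 ⟨hL, by simp, fun p hp' q hq => ?_⟩
      rw [List.mem_singleton.1 hq]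
      rcases List.eq_nil_or_concat L with rfl | ⟨L, p', rfl⟩
      · simp at hp'
      simp only [List.concat_eq_append] at *
      -- It suffices to compare with the last column `p'` of `L`. If it had the same upper letter
      -- and a larger lower one, the new box would lie strictly below the previous one, and `u`
      -- would occur in a row above the box just removed.
      have key : LexLE p' (u, v) := by
        have hu' : p'.1 ≤ u := by
          refine humax _ (hp.mem_iff.2 (List.mem_cons_of_mem _ ?_))
          have := (rskInv_foldl hL).permQ
          rw [hrun] at this
          exact this.mem_iff.2 (by simp)
        rcases hu'.lt_or_eq with hu' | hu'
        · exact Or.inl hu'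
        refine Or.inr ⟨hu', ?_⟩
        by_contra! hv
        rw [List.pairwise_append] at hL
        have inv := rskInv_foldl hL.1
        rw [List.foldl_append] at hrun
        generalize L.foldl rskStep ([], []) = PQ at *
        obtain ⟨P'', Q''⟩ := PQ
        simp only [List.foldl_cons, List.foldl_nil, rskStep, Prod.mk.injEq] at hrun
        have hlt := insertion_insertion_of_lt hv P''
        rw [hrun.1, hins] at hlt
        have hlen : P''.length = Q''.length := by simpa using congrArg List.length inv.shape
        obtain ⟨r, hr, hur⟩ := exists_mem_take_addBox (u := p'.1) (Q := Q'')
          (hlen ▸ insertion_snd_le _ _) hlt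
        rw [hrun.2] at hr
        exact ht r hr (hu' ▸ hur)
      rcases List.mem_append.1 hp' with hp' | hp'
      · exact ((List.pairwise_append.1 hL).2.2 p hp' p' (by simp)).trans key
      · rwa [List.mem_singleton.1 hp']
    · rw [List.foldl_append, hrun]
      simp [rskStep, hins]

/-! ### Semistandard tableaux as lists of rows -/

theorem over_map_range {a b : ℕ} {f g : ℕ → ℕ} (h : b ≤ a) (hfg : ∀ j < b, f j < g j) :
    Over ((List.range a).map f) ((List.range b).map g) := by
  induction b generalizing a f g with
  | zero => simp
  | succ b ih =>
    obtain ⟨a, rfl⟩ : ∃ c, a = c + 1 := ⟨a - 1, by omega⟩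
    rw [List.range_succ_eq_map, List.range_succ_eq_map, List.map_cons, List.map_cons,
      List.map_map, List.map_map]
    exact ⟨hfg 0 b.succ_pos, ih (Nat.le_of_succ_le_succ h) fun j hj => hfg _ (Nat.succ_lt_succ hj)⟩

theorem isTab_map_range {n : ℕ} {l : ℕ → ℕ} {f : ℕ → ℕ → ℕ} (hpos : ∀ i < n, 0 < l i)
    (hl : ∀ i, i + 1 < n → l (i + 1) ≤ l i)
    (hrow : ∀ i < n, ∀ j j', j < j' → j' < l i → f i j ≤ f i j')
    (hcol : ∀ i, i + 1 < n → ∀ j < l (i + 1), f i j < f (i + 1) j) :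
    IsTab ((List.range n).map fun i => (List.range (l i)).map (f i)) := by
  induction n generalizing l f with
  | zero => trivial
  | succ n ih =>
    rw [List.range_succ_eq_map, List.map_cons, List.map_map]
    refine ⟨?_, ?_, ?_, ih (l := fun i => l (i + 1)) (f := fun i => f (i + 1))
      (fun i hi => hpos _ (Nat.succ_lt_succ hi)) (fun i hi => hl _ (Nat.succ_lt_succ hi))
      (fun i hi => hrow _ (Nat.succ_lt_succ hi)) (fun i hi => hcol _ (Nat.succ_lt_succ hi))⟩
    · simpa using (hpos 0 n.succ_pos).ne'
    · rw [List.pairwise_map]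
      refine List.pairwise_lt_range.imp_of_mem fun _ hb hab => ?_
      exact hrow 0 n.succ_pos _ _ hab (List.mem_range.1 hb)
    · cases n with
      | zero => simp
      | succ n =>
        rw [List.range_succ_eq_map]
        exact over_map_range (hl 0 (by omega)) (hcol 0 (by omega))

theorem isTab_rows {lam : YoungDiagram} (T : SemistandardYoungTableau lam) : IsTab (rows T) := by
  refine isTab_map_range (fun i hi => ?_) (fun i _ => lam.rowLen_anti i (i + 1) i.le_succ) ?_ ?_
  · rwa [← YoungDiagram.mem_iff_lt_rowLen, YoungDiagram.mem_iff_lt_colLen]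
  · exact fun i _ j j' h h' => T.row_weak h (YoungDiagram.mem_iff_lt_rowLen.2 h')
  · exact fun i _ j h => T.col_strict i.lt_succ_self (YoungDiagram.mem_iff_lt_rowLen.2 h)

theorem map_length_rows {lam : YoungDiagram} (T : SemistandardYoungTableau lam) :
    (rows T).map List.length = lam.rowLens := by
  simp [rows, YoungDiagram.rowLens]

theorem rowLens_injective : Function.Injective YoungDiagram.rowLens := fun _ _ h =>
  YoungDiagram.equivListRowLens.injective (Subtype.ext h)

theorem rows_injective {lam : YoungDiagram} {T T' : SemistandardYoungTableau lam}
    (h : rows T = rows T') : T = T' := by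
  ext i j
  by_cases hc : (i, j) ∈ lam
  · simp only [rows, List.map_inj_left, List.mem_range] at h
    refine h i ?_ j (YoungDiagram.mem_iff_lt_rowLen.1 hc)
    rw [← YoungDiagram.mem_iff_lt_colLen]
    exact lam.up_left_mem le_rfl (Nat.zero_le _) hc
  · rw [T.zeros hc, T'.zeros hc]

theorem Over.getD_lt {r s : List ℕ} (h : Over r s) {j : ℕ} (hj : j < s.length) :
    r.getD j 0 < s.getD j 0 := by
  induction r generalizing s j with
  | nil =>
    cases s with
    | nil => simp at hj
    | cons b s => exact h.elim
  | cons a r ih =>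
    cases s with
    | nil => simp at hj
    | cons b s =>
      cases j with
      | zero => exact h.1
      | succ j => exact ih h.2 (Nat.lt_of_succ_lt_succ hj)

theorem IsTab.over_getD {L : List (List ℕ)} (h : IsTab L) (i : ℕ) :
    Over (L.getD i []) (L.getD (i + 1) []) := by
  induction L generalizing i with
  | nil => simp
  | cons r rs ih =>
    cases i with
    | zero =>
      have := h.2.2.1
      cases rs <;> exact this
    | succ i => exact ih h.2.2.2 i

theorem IsTab.col_lt {L : List (List ℕ)} (h : IsTab L) {i i' j : ℕ} (hi : i < i')
    (hj : j < (L.getD i' []).length) : (L.getD i []).getD j 0 < (L.getD i' []).getD j 0 := by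
  induction i', hi using Nat.le_induction with
  | base => exact (h.over_getD i).getD_lt hj
  | succ k _ ih =>
    exact (ih (hj.trans_le (h.over_getD k).length_le)).trans ((h.over_getD k).getD_lt hj)

theorem Dec.pairwise {l : List ℕ} (h : Dec l) : l.Pairwise (· ≥ ·) := by
  induction l with
  | nil => simp
  | cons a l ih =>
    refine List.pairwise_cons.2 ⟨fun b hb => ?_, ih h.2⟩
    cases l with
    | nil => simp at hb
    | cons c l =>
      have h1 := h.1
      rcases List.mem_cons.1 hb with rfl | hb
      · exact h1
      · exact ((List.pairwise_cons.1 (ih h.2)).1 b hb).trans h1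

theorem exists_rows_eq {L : List (List ℕ)} (h : IsTab L) :
    ∃ (lam : YoungDiagram) (T : SemistandardYoungTableau lam), rows T = L := by
  have hs : (L.map List.length).SortedGE := h.dec.pairwise.sortedGE
  have hlens := YoungDiagram.rowLens_ofRowLens_eq_self (hw := hs) fun a ha => by
    obtain ⟨r, hr, rfl⟩ := List.mem_map.1 ha
    exact List.length_pos_iff.2 (h.ne_nil r hr)
  have hmem : ∀ i j, (i, j) ∈ YoungDiagram.ofRowLens _ hs ↔ j < (L.getD i []).length := by
    intro i j
    rw [YoungDiagram.mem_ofRowLens]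
    by_cases hi : i < L.length
    · simp [hi]
    · simp [hi]
  refine ⟨YoungDiagram.ofRowLens _ hs,
    -- The default 0 outside the lists is the value that `zeros'` demands outside the diagram.
    { entry := fun i j => (L.getD i []).getD j 0
      row_weak' := ?_
      col_strict' := ?_
      zeros' := ?_ }, ?_⟩
  · intro i j j' hj hc
    rw [hmem] at hc
    have hp : (L.getD i []).Pairwise (· ≤ ·) := by
      by_cases hi : i < L.length
      · simpa [hi] using h.pairwise _ (List.getElem_mem hi)
      · simp [hi]
    rw [List.getD_eq_getElem _ _ (hj.trans hc), List.getD_eq_getElem _ _ hc]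
    exact List.pairwise_iff_getElem.1 hp _ _ _ _ hj
  · intro i i' j hi hc
    exact h.col_lt hi ((hmem _ _).1 hc)
  · intro i j hc
    rw [hmem, not_lt] at hc
    exact List.getD_eq_default _ _ hc
  · have hcol : (YoungDiagram.ofRowLens _ hs).colLen 0 = L.length := by
      simpa using congrArg List.length hlens
    refine List.ext_getElem (by simp [rows, hcol]) fun i h1 h2 => ?_
    have hrow : (YoungDiagram.ofRowLens _ hs).rowLen i = L[i].length := by
      have := congrArg (fun l => l[i]?) hlens
      simpa [YoungDiagram.rowLens, hcol, h2] using this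
    refine List.ext_getElem (by simp [rows, hrow]) fun j h3 h4 => ?_
    simp only [rows, List.getElem_map, List.getElem_range]
    change (L.getD i []).getD j 0 = _
    rw [List.getD_eq_getElem _ _ h2, List.getD_eq_getElem _ _ h4]

theorem sum_cells {M : Type*} [AddCommMonoid M] (lam : YoungDiagram) (g : ℕ × ℕ → M) :
    ∑ c ∈ lam.cells, g c =
      ∑ i ∈ Finset.range (lam.colLen 0), ∑ j ∈ Finset.range (lam.rowLen i), g (i, j) := by
  refine Finset.sum_finset_product _ _ _ fun c => ?_
  rw [YoungDiagram.mem_cells, Finset.mem_range, Finset.mem_range,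
    ← YoungDiagram.mem_iff_lt_rowLen, ← YoungDiagram.mem_iff_lt_colLen]
  exact ⟨fun h => ⟨lam.up_left_mem le_rfl (Nat.zero_le _) h, h⟩, fun h => h.2⟩

theorem sum_map_range (n : ℕ) (f : ℕ → ℕ) :
    ((List.range n).map f).sum = ∑ i ∈ Finset.range n, f i := by
  rw [Finset.sum_eq_multiset_sum]; rfl

theorem count_rows {lam : YoungDiagram} (T : SemistandardYoungTableau lam) (k : ℕ) :
    (rows T).flatten.count k = (lam.cells.filter fun c => T c.1 c.2 = k).card := by
  rw [Finset.card_filter, sum_cells, List.count_flatten, rows, List.map_map, sum_map_range]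
  refine Finset.sum_congr rfl fun i _ => ?_
  rw [← Finset.card_filter, Function.comp, List.count, List.countP_map, List.countP_eq_length_filter]
  simp only [Finset.card_def, Finset.filter_val, Finset.range_val, Multiset.range,
    Multiset.filter_coe, Multiset.coe_card]
  rfl

theorem hasContent_iff {lam ρ : YoungDiagram} {T : SemistandardYoungTableau lam} :
    HasContent T ρ ↔ ∀ k, (rows T).flatten.count k = ρ.rowLen k := by
  simp only [HasContent, count_rows]

/-! ### The statistics of shapes -/

theorem card_eq_sum (lam : YoungDiagram) : lam.card = lam.rowLens.sum := by
  rw [YoungDiagram.rowLens, sum_map_range, YoungDiagram.card, Finset.card_eq_sum_ones, sum_cells]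
  simp

theorem ang_eq (lam : YoungDiagram) : ang lam = ∑ c ∈ lam.cells, (c.2 + 1) := by
  rw [sum_cells, ang, YoungDiagram.rowLens, List.map_map, sum_map_range]
  refine Finset.sum_congr rfl fun i _ => ?_
  have := Finset.sum_range_id_mul_two (lam.rowLen i + 1)
  rw [Finset.sum_range_succ'] at this
  simp only [Function.comp, add_zero, Nat.add_sub_cancel] at *
  rw [mul_comm (lam.rowLen i), ← this, Nat.mul_div_cancel _ two_pos]

theorem rowWeight_append_singleton (l : List ℕ) (a : ℕ) :
    rowWeight (l ++ [a]) = rowWeight l + l.length * a := by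
  induction l with
  | nil => simp [rowWeight]
  | cons b l ih => simp [rowWeight, ih]; ring

theorem rowWeight_map_range (n : ℕ) (f : ℕ → ℕ) :
    rowWeight ((List.range n).map f) = ∑ i ∈ Finset.range n, i * f i := by
  induction n with
  | zero => rfl
  | succ n ih =>
    rw [List.range_succ, List.map_append, List.map_singleton, rowWeight_append_singleton, ih,
      Finset.sum_range_succ]
    simp

theorem rowWeight_rowLens (lam : YoungDiagram) :
    rowWeight lam.rowLens = ∑ c ∈ lam.cells, c.1 := by
  rw [sum_cells, YoungDiagram.rowLens, rowWeight_map_range]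
  simp [mul_comm]

/-- Modulo 2 only the odd row indices contribute to the row weight; counted from 1, they are the
even ones. -/
theorem neg_one_pow_evenRowSum (lam : YoungDiagram) :
    (-1 : ℤ) ^ evenRowSum lam = (-1) ^ rowWeight lam.rowLens := by
  rw [evenRowSum, YoungDiagram.rowLens, rowWeight_map_range, ← Finset.prod_pow_eq_pow_sum,
    ← Finset.prod_pow_eq_pow_sum, Finset.prod_filter]
  refine Finset.prod_congr rfl fun i _ => ?_
  rw [pow_mul]
  split_ifs with h
  · rw [(Nat.odd_iff.2 h).neg_one_pow]
  · rw [(Nat.even_iff.2 (by omega)).neg_one_pow, one_pow]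

/-- Summing (column index + 1) over the cells of the transpose gives the row weight of λ plus |λ|,
and |λ| then occurs twice. -/
theorem neg_one_pow_ang_transpose (lam : YoungDiagram) :
    (-1 : ℤ) ^ (ang lam.transpose + lam.card) = (-1) ^ rowWeight lam.rowLens := by
  have h : ang lam.transpose = ∑ c ∈ lam.cells, c.1 + lam.card := by
    rw [ang_eq, YoungDiagram.card, Finset.card_eq_sum_ones, ← Finset.sum_add_distrib]
    refine Finset.sum_nbij' Prod.swap Prod.swap ?_ ?_ ?_ ?_ ?_ <;> simp
  rw [h, rowWeight_rowLens, add_assoc, pow_add, ← two_mul, pow_mul]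
  simp

/-! ### Inversions of permutations and of words -/

/-- The number of inversions of a function. -/
def funInv {n : ℕ} {α : Type*} [LinearOrder α] (f : Fin n → α) : ℕ :=
  (Finset.univ.filter fun p : Fin n × Fin n => p.1 < p.2 ∧ f p.2 < f p.1).card

/-- A sorting permutation has to reverse every inverted pair of values. -/
theorem funInv_le_invCount {n : ℕ} {α : Type*} [LinearOrder α] {f : Fin n → α}
    {σ : Equiv.Perm (Fin n)} (h : Monotone (f ∘ σ)) : funInv f ≤ invCount σ := by
  refine Finset.card_le_card_of_injOn (fun p => (σ.symm p.2, σ.symm p.1)) ?_ ?_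
  · intro p hp
    simp only [Finset.coe_filter, Finset.mem_univ, true_and, Set.mem_ofPred_eq,
      Equiv.apply_symm_apply] at hp ⊢
    refine ⟨lt_of_not_ge fun hle => ?_, hp.1⟩
    exact hp.2.not_ge (by simpa using h hle)
  · intro p _ q _ hpq
    simp only [Prod.mk.injEq, EmbeddingLike.apply_eq_iff_eq] at hpq
    exact Prod.ext hpq.2 hpq.1

/-- `Tuple.sort` is stable: it never reverses a pair of equal values, so the lower bound is
attained. -/
theorem invCount_sort {n : ℕ} {α : Type*} [LinearOrder α] (f : Fin n → α) :
    invCount (Tuple.sort f) = funInv f := by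
  obtain ⟨h1, h2⟩ := Tuple.eq_sort_iff.1 (rfl : Tuple.sort f = Tuple.sort f)
  refine le_antisymm ?_ (funInv_le_invCount h1)
  refine Finset.card_le_card_of_injOn (fun p => (Tuple.sort f p.2, Tuple.sort f p.1)) ?_ ?_
  · intro p hp
    simp only [Finset.coe_filter, Finset.mem_univ, true_and, Set.mem_ofPred_eq] at hp ⊢
    exact ⟨hp.2, lt_of_le_of_ne (h1 hp.1.le) fun e => (h2 _ _ hp.1 e).asymm hp.2⟩
  · intro p _ q _ hpq
    simp only [Prod.mk.injEq, EmbeddingLike.apply_eq_iff_eq] at hpq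
    exact Prod.ext hpq.2 hpq.1

theorem sum_ite_get {α : Type*} (P : α → Prop) [DecidablePred P] (l : List α) :
    ∑ q : Fin l.length, (if P (l.get q) then 1 else 0) = l.countP (P ·) := by
  induction l with
  | nil => rfl
  | cons a l ih =>
    rw [List.countP_cons, ← ih]
    simp only [List.length_cons, Fin.sum_univ_succ, List.get_cons_zero, decide_eq_true_eq]
    rw [add_comm]
    rfl

theorem funInv_get (w : List ℕ) : funInv w.get = inv w := by
  induction w with
  | nil => rfl
  | cons a w ih =>
    rw [inv_cons, ← ih, ← sum_ite_get, funInv, funInv, Finset.card_filter, Finset.card_filter,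
      Fintype.sum_prod_type, Fintype.sum_prod_type]
    simp only [List.length_cons, Fin.sum_univ_succ, List.get_cons_zero,
      Fin.succ_lt_succ_iff, Fin.succ_pos, true_and, false_and, if_false, zero_add,
      Fin.not_lt_zero]
    rfl

theorem wordSign_eq (w : List ℕ) : wordSign w = (-1) ^ inv w := by
  rw [wordSign, ← funInv_get]
  congr 1
  refine IsLeast.csInf_eq ⟨⟨Tuple.sort w.get, Tuple.monotone_sort _, invCount_sort _⟩, ?_⟩
  rintro _ ⟨σ, hσ, rfl⟩
  exact funInv_le_invCount hσ

theorem tableauSign_eq {lam : YoungDiagram} (T : SemistandardYoungTableau lam) :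
    tableauSign T = (-1) ^ inv (rowsWord (rows T)) := wordSign_eq _

/-! ### Two-line arrays of matrices -/

/-- The number of pairs of positions at which the first coordinate increases and the second
coordinate decreases. -/
def crossCount {n r s : ℕ} (F : Fin n → Fin r × Fin s) : ℕ :=
  (Finset.univ.filter fun p : Fin n × Fin n =>
    (F p.1).1 < (F p.2).1 ∧ (F p.2).2 < (F p.1).2).card

/-- The number of positions at which each pair of values is taken. -/
def fiberCard {n r s : ℕ} (F : Fin n → Fin r × Fin s) : Matrix (Fin r) (Fin s) ℕ :=
  fun i j => (Finset.univ.filter fun p => F p = (i, j)).card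

theorem card_filter_rel {ι α : Type*} [Fintype ι] [Fintype α] [DecidableEq α] (F : ι → α)
    (R : α → α → Prop) [DecidableRel R] :
    (Finset.univ.filter fun p : ι × ι => R (F p.1) (F p.2)).card =
      ∑ a, ∑ b, if R a b then (Finset.univ.filter fun p => F p = a).card *
        (Finset.univ.filter fun p => F p = b).card else 0 := by
  rw [Finset.card_eq_sum_card_fiberwise (f := fun p => (F p.1, F p.2)) (t := Finset.univ)
    (fun _ _ => Finset.mem_coe.2 (Finset.mem_univ _)), Fintype.sum_prod_type]
  refine Finset.sum_congr rfl fun a _ => Finset.sum_congr rfl fun b _ => ?_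
  rw [← Finset.card_product, Finset.filter_filter]
  split_ifs with h
  · congr 1
    ext p
    simp only [Finset.mem_filter, Finset.mem_univ, true_and, Finset.mem_product, Prod.mk.injEq]
    constructor
    · exact fun h => h.2
    · rintro ⟨rfl, rfl⟩
      exact ⟨h, rfl, rfl⟩
  · rw [Finset.card_eq_zero, Finset.filter_eq_empty_iff]
    rintro p - ⟨h1, h2⟩
    simp only [Prod.mk.injEq] at h2
    exact h (h2.1 ▸ h2.2 ▸ h1)

theorem matrixSign_fiberCard {n r s : ℕ} (F : Fin n → Fin r × Fin s) :
    matrixSign (fiberCard F) = (-1) ^ crossCount F := by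
  -- The sums are exchanged because `matrixSign` runs over the lower left entry first.
  rw [crossCount, card_filter_rel F fun a b => a.1 < b.1 ∧ b.2 < a.2, Finset.sum_comm]
  simp only [Fintype.sum_prod_type, ← Finset.prod_pow_eq_pow_sum, matrixSign]
  refine Finset.prod_congr rfl fun i _ => Finset.prod_congr rfl fun j _ =>
    Finset.prod_congr rfl fun i' _ => Finset.prod_congr rfl fun j' _ => ?_
  split_ifs
  · rw [mul_comm]; rfl
  · rfl

/-- The two-line array of a matrix, with bounded entries. -/
def finTwoLineArray {r s : ℕ} (A : Matrix (Fin r) (Fin s) ℕ) : List (Fin r × Fin s) :=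
  (List.finRange r).flatMap fun i =>
    (List.finRange s).flatMap fun j => List.replicate (A i j) (i, j)

theorem twoLineArray_eq_map {r s : ℕ} (A : Matrix (Fin r) (Fin s) ℕ) :
    twoLineArray A = (finTwoLineArray A).map (Prod.map Fin.val Fin.val) := by
  simp [twoLineArray, finTwoLineArray, List.map_flatMap]

theorem pairwise_finTwoLineArray {r s : ℕ} (A : Matrix (Fin r) (Fin s) ℕ) :
    (finTwoLineArray A).Pairwise fun p q => p.1 < q.1 ∨ p.1 = q.1 ∧ p.2 ≤ q.2 := by
  simp only [finTwoLineArray, List.pairwise_flatMap, List.mem_flatMap, List.mem_replicate,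
    List.mem_finRange, true_and, forall_exists_index, and_imp, forall_true_left]
  refine ⟨fun i => ⟨fun j => ?_, ?_⟩, ?_⟩
  · exact List.pairwise_replicate.2 (Or.inr (Or.inr ⟨rfl, le_rfl⟩))
  · refine (List.pairwise_lt_finRange s).imp ?_
    rintro j j' h _ - rfl _ - rfl
    exact Or.inr ⟨rfl, h.le⟩
  · refine (List.pairwise_lt_finRange r).imp ?_
    rintro i i' h _ j - rfl _ j' - rfl
    exact Or.inl h

theorem pairwise_twoLineArray {r s : ℕ} (A : Matrix (Fin r) (Fin s) ℕ) :
    (twoLineArray A).Pairwise LexLE := by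
  rw [twoLineArray_eq_map, List.pairwise_map]
  refine (pairwise_finTwoLineArray A).imp ?_
  rintro ⟨a, b⟩ ⟨c, d⟩ h
  simpa [LexLE, Fin.ext_iff] using h

theorem count_finTwoLineArray {r s : ℕ} (A : Matrix (Fin r) (Fin s) ℕ) (i : Fin r) (j : Fin s) :
    (finTwoLineArray A).count (i, j) = A i j := by
  simp only [finTwoLineArray, List.count_flatMap, Function.comp_def, ← Fin.sum_univ_def,
    List.count_replicate, beq_iff_eq, Prod.mk.injEq]
  rw [Finset.sum_eq_single i, Finset.sum_eq_single j] <;> simp +contextual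

theorem fiberCard_get {r s : ℕ} (A : Matrix (Fin r) (Fin s) ℕ) :
    fiberCard (finTwoLineArray A).get = A := by
  ext i j
  rw [fiberCard, Finset.card_filter, sum_ite_get (· = (i, j)), ← count_finTwoLineArray A i j]
  exact List.countP_congr fun p _ => by simp

/-- In lexicographic order a descent of second coordinates between two positions forces the first
coordinates to increase strictly, so inversions of the lower row are exactly the crossing pairs. -/
theorem matrixSign_eq {r s : ℕ} (A : Matrix (Fin r) (Fin s) ℕ) :
    matrixSign A = (-1) ^ inv ((twoLineArray A).map Prod.snd) := by
  have h : inv ((twoLineArray A).map Prod.snd) = crossCount (finTwoLineArray A).get := by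
    rw [twoLineArray_eq_map, List.map_map]
    have hp := List.pairwise_iff_get.1 (pairwise_finTwoLineArray A)
    generalize finTwoLineArray A = l at hp
    rw [← funInv_get, funInv, crossCount]
    have hl : (l.map (Prod.snd ∘ Prod.map Fin.val Fin.val)).length = l.length := by simp
    refine Finset.card_bij' (fun p _ => (p.1.cast hl, p.2.cast hl))
      (fun p _ => (p.1.cast hl.symm, p.2.cast hl.symm)) ?_ ?_ ?_ ?_
    · intro p hp'
      simp only [Finset.mem_filter, Finset.mem_univ, true_and] at hp' ⊢
      have h2 : (l.get (p.2.cast hl)).2 < (l.get (p.1.cast hl)).2 := by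
        simpa using hp'.2
      refine ⟨?_, h2⟩
      rcases hp (p.1.cast hl) (p.2.cast hl) hp'.1 with h | h
      · exact h
      · exact absurd h.2 h2.not_ge
    · intro p hp'
      simp only [Finset.mem_filter, Finset.mem_univ, true_and] at hp' ⊢
      refine ⟨?_, by simpa using hp'.2⟩
      by_contra hlt
      rcases (not_lt.1 hlt).lt_or_eq with hlt | e
      · rcases hp p.2 p.1 hlt with h | h
        · exact h.asymm hp'.1
        · exact h.1.not_gt hp'.1
      · have e' : p.2 = p.1 := Fin.ext (by simpa using congrArg Fin.val e)
        exact (e' ▸ hp'.1).ne rfl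
    · intro p _; rfl
    · intro p _; rfl
  rw [h, ← matrixSign_fiberCard, fiberCard_get]

theorem count_map_fst_twoLineArray {r s : ℕ} (A : Matrix (Fin r) (Fin s) ℕ) (k : ℕ) :
    ((twoLineArray A).map Prod.fst).count k = ∑ i : Fin r, if (i : ℕ) = k then ∑ j, A i j else 0 := by
  simp only [twoLineArray, List.map_flatMap, List.map_replicate, List.count_flatMap,
    Function.comp_def, ← Fin.sum_univ_def, List.count_replicate, beq_iff_eq]
  refine Finset.sum_congr rfl fun i _ => ?_
  split_ifs <;> simp

theorem count_map_snd_twoLineArray {r s : ℕ} (A : Matrix (Fin r) (Fin s) ℕ) (k : ℕ) :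
    ((twoLineArray A).map Prod.snd).count k = ∑ j : Fin s, if (j : ℕ) = k then ∑ i, A i j else 0 := by
  simp only [twoLineArray, List.map_flatMap, List.map_replicate, List.count_flatMap,
    Function.comp_def, ← Fin.sum_univ_def, List.count_replicate, beq_iff_eq]
  rw [Finset.sum_comm]
  refine Finset.sum_congr rfl fun i _ => ?_
  split_ifs <;> simp

theorem twoLineArray_injective {r s : ℕ} {A B : Matrix (Fin r) (Fin s) ℕ}
    (h : twoLineArray A = twoLineArray B) : A = B := by
  rw [twoLineArray_eq_map, twoLineArray_eq_map] at h
  have h' := List.map_injective_iff.2 (Fin.val_injective.prodMap Fin.val_injective) h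
  ext i j
  rw [← count_finTwoLineArray A, h', count_finTwoLineArray]

/-- The matrix of multiplicities works, since a list sorted for an antisymmetric relation is
determined by its multiset. -/
theorem exists_twoLineArray_eq {r s : ℕ} {L : List (ℕ × ℕ)} (hL : L.Pairwise LexLE)
    (hr : ∀ p ∈ L, p.1 < r) (hs : ∀ p ∈ L, p.2 < s) :
    ∃ A : Matrix (Fin r) (Fin s) ℕ, twoLineArray A = L := by
  refine ⟨Matrix.of fun i j => L.count ((i : ℕ), (j : ℕ)), ?_⟩
  refine List.Perm.eq_of_pairwise (fun _ _ _ _ h h' => h.antisymm h')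
    (pairwise_twoLineArray _) hL ?_
  rw [List.perm_iff_count]
  rintro ⟨a, b⟩
  by_cases hab : a < r ∧ b < s
  · have := List.count_map_of_injective
      (finTwoLineArray <| Matrix.of fun i j => L.count ((i : ℕ), (j : ℕ))) (Prod.map Fin.val Fin.val)
      (Fin.val_injective.prodMap Fin.val_injective) (⟨a, hab.1⟩, ⟨b, hab.2⟩)
    rw [twoLineArray_eq_map]
    exact this.trans (count_finTwoLineArray _ _ _)
  · rw [List.count_eq_zero.2, List.count_eq_zero.2]
    · exact fun h => hab ⟨hr _ h, hs _ h⟩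
    · rw [twoLineArray_eq_map, List.mem_map]
      rintro ⟨⟨i, j⟩, -, e⟩
      simp only [Prod.map_apply, Prod.mk.injEq] at e
      exact hab ⟨e.1 ▸ i.2, e.2 ▸ j.2⟩

/-! ### Double cosets of Young subgroups -/

theorem exists_perm_comp_eq {n : ℕ} {γ : Type*} [DecidableEq γ] {f g : Fin n → γ}
    (h : ∀ c, (Finset.univ.filter fun p => f p = c).card =
      (Finset.univ.filter fun p => g p = c).card) :
    ∃ σ : Equiv.Perm (Fin n), ∀ p, g (σ p) = f p :=
  ⟨Equiv.ofFiberEquiv fun c => Fintype.equivOfCardEq (by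
    rw [Fintype.card_subtype, Fintype.card_subtype, h c]), Equiv.ofFiberEquiv_map _⟩

theorem eq_of_monotone_of_card_fiber {n : ℕ} {γ : Type*} [LinearOrder γ] {f g : Fin n → γ}
    (hf : Monotone f) (hg : Monotone g)
    (h : ∀ c, (Finset.univ.filter fun p => f p = c).card =
      (Finset.univ.filter fun p => g p = c).card) : f = g := by
  obtain ⟨σ, hσ⟩ := exists_perm_comp_eq h
  have e : g ∘ σ = f := funext hσ
  have := Tuple.unique_monotone (f := g) (σ := σ) (τ := 1) (by rwa [e]) (by simpa using hg)
  rw [← e, this]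
  rfl

theorem card_filter_comp_perm {ι : Type*} [Fintype ι] (σ : Equiv.Perm ι) (P : ι → Prop)
    [DecidablePred P] :
    (Finset.univ.filter fun p => P (σ p)).card = (Finset.univ.filter P).card := by
  rw [Finset.card_filter, Finset.card_filter]
  exact Equiv.sum_comp σ fun p => if P p then 1 else 0

section Blocks

variable {n r s : ℕ} (b : Fin n → Fin r) (a : Fin n → Fin s)

/-- The blocks of the value and of the argument of a permutation. -/
def blockPair (σ : Equiv.Perm (Fin n)) (p : Fin n) : Fin r × Fin s := (b (σ p), a p)

/-- If the counts agree, a permutation `k` matches the block pairs of σ and τ. It preserves the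
blocks of arguments, and the factor τ k⁻¹ σ⁻¹ preserves the blocks of values. -/
theorem mk_eq_mk_iff_fiberCard_eq {H K : Subgroup (Equiv.Perm (Fin n))}
    (hH : ∀ σ, σ ∈ H ↔ ∀ p, b (σ p) = b p) (hK : ∀ σ, σ ∈ K ↔ ∀ p, a (σ p) = a p)
    (σ τ : Equiv.Perm (Fin n)) :
    DoubleCoset.mk H K σ = DoubleCoset.mk H K τ ↔
      fiberCard (blockPair b a σ) = fiberCard (blockPair b a τ) := by
  rw [DoubleCoset.eq]
  constructor
  · rintro ⟨h, hh, k, hk, rfl⟩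
    ext i j
    rw [fiberCard, fiberCard, ← card_filter_comp_perm k]
    congr 1
    ext p
    simp [blockPair, (hH h).1 hh, (hK k).1 hk]
  · intro h
    obtain ⟨k, hk⟩ := exists_perm_comp_eq (f := blockPair b a τ) (g := blockPair b a σ)
      fun c => (congrFun (congrFun h c.1) c.2).symm
    simp only [blockPair, Prod.mk.injEq] at hk
    refine ⟨τ * k⁻¹ * σ⁻¹, (hH _).2 fun p => ?_, k, (hK _).2 fun p => (hk p).2, by group⟩
    have := (hk (k⁻¹ (σ⁻¹ p))).1
    simpa using this.symm

theorem sum_fiberCard_right (σ : Equiv.Perm (Fin n)) (i : Fin r) :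
    ∑ j, fiberCard (blockPair b a σ) i j = (Finset.univ.filter fun p => b p = i).card := by
  rw [← card_filter_comp_perm σ, Finset.card_eq_sum_card_fiberwise (f := a) (t := Finset.univ)
    (fun _ _ => Finset.mem_coe.2 (Finset.mem_univ _))]
  simp only [Finset.filter_filter, fiberCard, blockPair, Prod.mk.injEq]

theorem sum_fiberCard_left (σ : Equiv.Perm (Fin n)) (j : Fin s) :
    ∑ i, fiberCard (blockPair b a σ) i j = (Finset.univ.filter fun p => a p = j).card := by
  rw [Finset.card_eq_sum_card_fiberwise (f := fun p => b (σ p)) (t := Finset.univ)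
    (fun _ _ => Finset.mem_coe.2 (Finset.mem_univ _))]
  simp only [Finset.filter_filter, fiberCard, blockPair, Prod.mk.injEq, and_comm]

variable {b a}

/-- Strict inequalities between blocks come from strict inequalities between positions, so every
crossing is an inversion of σ. -/
theorem crossCount_le_invCount (hb : Monotone b) (ha : Monotone a) (σ : Equiv.Perm (Fin n)) :
    crossCount (blockPair b a σ) ≤ invCount σ := by
  refine Finset.card_le_card_of_injOn Prod.swap ?_ Prod.swap_injective.injOn
  intro p hp
  rw [Finset.mem_coe, Finset.mem_filter] at hp ⊢
  replace hp := hp.2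
  refine ⟨Finset.mem_univ _, ?_⟩
  exact ⟨ha.reflect_lt hp.2, hb.reflect_lt hp.1⟩

theorem sum_sum_card_fiber (b : Fin n → Fin r) :
    ∑ i, (Finset.univ.filter fun p => b p = i).card = n := by
  rw [← Finset.card_eq_sum_card_fiberwise (fun _ _ => Finset.mem_coe.2 (Finset.mem_univ _))]
  simp

theorem length_finTwoLineArray (A : Matrix (Fin r) (Fin s) ℕ) :
    (finTwoLineArray A).length = ∑ i, ∑ j, A i j := by
  simp [finTwoLineArray, List.length_flatMap, ← Fin.sum_univ_def]

/-- The minimal representative is the stable sort, by second coordinate, of the lexicographic list F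
of matrix positions. The margins identify the first coordinates of F with b and the sorted second
coordinates with a. Stability and lexicographic order make every inversion a crossing. -/
theorem exists_perm_fiberCard_eq (hb : Monotone b) (ha : Monotone a)
    {A : Matrix (Fin r) (Fin s) ℕ}
    (hA : ∀ i, ∑ j, A i j = (Finset.univ.filter fun p => b p = i).card)
    (hA' : ∀ j, ∑ i, A i j = (Finset.univ.filter fun p => a p = j).card) :
    ∃ σ : Equiv.Perm (Fin n), fiberCard (blockPair b a σ) = A ∧
      invCount σ = crossCount (blockPair b a σ) := by
  obtain ⟨F, hF, hlex⟩ : ∃ F : Fin n → Fin r × Fin s, fiberCard F = A ∧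
      ∀ p q, p < q → (F p).1 < (F q).1 ∨ (F p).1 = (F q).1 ∧ (F p).2 ≤ (F q).2 := by
    have hl : (finTwoLineArray A).length = n := by
      rw [length_finTwoLineArray, Finset.sum_congr rfl fun i _ => hA i, sum_sum_card_fiber]
    have h1 := fiberCard_get A
    have h2 := List.pairwise_iff_get.1 (pairwise_finTwoLineArray A)
    generalize finTwoLineArray A = l at *
    subst hl
    exact ⟨l.get, h1, h2⟩
  have h1 : ∀ i, (Finset.univ.filter fun p => (F p).1 = i).card =
      (Finset.univ.filter fun p => b p = i).card := by
    intro i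
    rw [← hA, ← hF, Finset.card_eq_sum_card_fiberwise (f := fun p => (F p).2) (t := Finset.univ)
      (fun _ _ => Finset.mem_coe.2 (Finset.mem_univ _))]
    simp only [Finset.filter_filter, fiberCard, Prod.ext_iff]
  have h2 : ∀ j, (Finset.univ.filter fun p => (F p).2 = j).card =
      (Finset.univ.filter fun p => a p = j).card := by
    intro j
    rw [← hA', ← hF, Finset.card_eq_sum_card_fiberwise (f := fun p => (F p).1) (t := Finset.univ)
      (fun _ _ => Finset.mem_coe.2 (Finset.mem_univ _))]
    simp only [Finset.filter_filter, fiberCard, Prod.ext_iff, and_comm]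
  have e1 : (fun p => (F p).1) = b := by
    refine eq_of_monotone_of_card_fiber (fun p q hpq => ?_) hb h1
    rcases hpq.lt_or_eq with hpq | rfl
    · rcases hlex p q hpq with h | h
      · exact h.le
      · exact h.1.le
    · exact le_rfl
  set f : Fin n → Fin s := fun p => (F p).2 with hf
  obtain ⟨k1, k2⟩ := Tuple.eq_sort_iff.1 (rfl : Tuple.sort f = Tuple.sort f)
  generalize Tuple.sort f = σ at k1 k2
  have e2 : f ∘ σ = a := by
    refine eq_of_monotone_of_card_fiber k1 ha fun c => ?_
    rw [← h2 c]
    exact card_filter_comp_perm σ fun p => f p = c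
  have e3 : blockPair b a σ = F ∘ σ := by
    ext p
    · simp [blockPair, ← e1]
    · simp [blockPair, ← e2, hf]
  refine ⟨σ, ?_, le_antisymm ?_ (crossCount_le_invCount hb ha σ)⟩
  · rw [← hF, e3]
    ext i j
    exact card_filter_comp_perm σ fun p => F p = (i, j)
  · rw [e3]
    refine Finset.card_le_card_of_injOn Prod.swap ?_ Prod.swap_injective.injOn
    intro p hp
    simp only [Finset.coe_filter, Finset.mem_univ, true_and, Set.mem_ofPred_eq, Prod.fst_swap,
      Prod.snd_swap, Function.comp_apply] at hp ⊢
    have hlt : (F (σ p.1)).2 < (F (σ p.2)).2 :=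
      lt_of_le_of_ne (k1 hp.1.le) fun e => (k2 _ _ hp.1 e).asymm hp.2
    refine ⟨?_, hlt⟩
    rcases hlex _ _ hp.2 with h | h
    · exact h
    · exact absurd h.2 hlt.not_ge

theorem finsum_neg_one_pow_length (hb : Monotone b) (ha : Monotone a)
    {H K : Subgroup (Equiv.Perm (Fin n))}
    (hH : ∀ σ, σ ∈ H ↔ ∀ p, b (σ p) = b p) (hK : ∀ σ, σ ∈ K ↔ ∀ p, a (σ p) = a p) :
    (∑ᶠ c : DoubleCoset.Quotient (H : Set (Equiv.Perm (Fin n))) (K : Set (Equiv.Perm (Fin n))),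
      (-1 : ℤ) ^ sInf {l | ∃ σ, DoubleCoset.mk H K σ = c ∧ invCount σ = l}) =
    ∑ᶠ A : {A : Matrix (Fin r) (Fin s) ℕ //
      (∀ i, ∑ j, A i j = (Finset.univ.filter fun p => b p = i).card) ∧
        ∀ j, ∑ i, A i j = (Finset.univ.filter fun p => a p = j).card}, matrixSign A.1 := by
  have hout : ∀ c : DoubleCoset.Quotient (H : Set (Equiv.Perm (Fin n)))
      (K : Set (Equiv.Perm (Fin n))), DoubleCoset.mk H K (Quotient.out c) = c :=
    fun c => Quotient.out_eq c
  refine finsum_eq_of_bijective (fun c => ⟨fiberCard (blockPair b a (Quotient.out c)),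
    sum_fiberCard_right b a _, sum_fiberCard_left b a _⟩) ⟨fun c d h => ?_, fun A => ?_⟩
    fun c => ?_
  · rw [← hout c, ← hout d, mk_eq_mk_iff_fiberCard_eq b a hH hK]
    exact congrArg Subtype.val h
  · obtain ⟨σ, hσ, -⟩ := exists_perm_fiberCard_eq hb ha A.2.1 A.2.2
    refine ⟨DoubleCoset.mk H K σ, Subtype.ext ?_⟩
    rw [← hσ]
    exact (mk_eq_mk_iff_fiberCard_eq b a hH hK _ _).1 (hout _)
  · simp only [matrixSign_fiberCard]
    congr 1
    obtain ⟨σ, hσ, hl⟩ := exists_perm_fiberCard_eq hb ha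
      (sum_fiberCard_right b a (Quotient.out c)) (sum_fiberCard_left b a (Quotient.out c))
    have hcross : ∀ τ : Equiv.Perm (Fin n), DoubleCoset.mk H K τ = c →
        crossCount (blockPair b a τ) = crossCount (blockPair b a (Quotient.out c)) := by
      intro τ hτ
      have := (mk_eq_mk_iff_fiberCard_eq b a hH hK τ (Quotient.out c)).1 (hτ.trans (hout c).symm)
      simp only [crossCount, card_filter_rel _
        fun (x y : Fin r × Fin s) => x.1 < y.1 ∧ y.2 < x.2]
      refine Finset.sum_congr rfl fun x _ => Finset.sum_congr rfl fun y _ => ?_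
      exact if_congr Iff.rfl (congrArg₂ _ (congrFun (congrFun this x.1) x.2)
        (congrFun (congrFun this y.1) y.2)) rfl
    have hσc : DoubleCoset.mk H K σ = c :=
      ((mk_eq_mk_iff_fiberCard_eq b a hH hK _ _).2 hσ).trans (hout c)
    refine IsLeast.csInf_eq ⟨⟨σ, hσc, hl.trans (hcross σ hσc)⟩, ?_⟩
    rintro _ ⟨τ, hτ, rfl⟩
    exact (hcross τ hτ).symm.trans_le (crossCount_le_invCount hb ha τ)

end Blocks

/-! ### Blocks of a composition -/

theorem blockIndex_mono (α : List ℕ) : Monotone (blockIndex α) := fun _ _ h =>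
  Finset.card_le_card fun _ hj => by
    simp only [Finset.mem_filter] at hj ⊢
    exact ⟨hj.1, hj.2.trans h⟩

theorem blockIndex_cons (a : ℕ) (α : List ℕ) (i : ℕ) :
    blockIndex (a :: α) i = if i < a then 0 else blockIndex α (i - a) + 1 := by
  rw [blockIndex, Finset.card_filter, List.length_cons, Finset.sum_range_succ', blockIndex,
    Finset.card_filter]
  rcases lt_or_ge i a with h | h
  · rw [if_pos h, Finset.sum_eq_zero]
    · simp [h]
    · intro j _
      rw [if_neg]
      simp only [List.take_succ_cons, List.sum_cons]
      omega
  · rw [if_neg h.not_gt]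
    congr 1
    · refine Finset.sum_congr rfl fun j _ => if_congr ?_ rfl rfl
      simp only [List.take_succ_cons, List.sum_cons]
      omega
    · simp [h]

theorem blockIndex_lt {α : List ℕ} {i : ℕ} (h : i < α.sum) : blockIndex α i < α.length := by
  induction α generalizing i with
  | nil => simp at h
  | cons a α ih =>
    rw [blockIndex_cons]
    split_ifs with hi
    · simp
    · rw [List.sum_cons] at h
      simpa using ih (i := i - a) (by omega)

theorem card_blockIndex_eq (α : List ℕ) (j : ℕ) :
    ((Finset.range α.sum).filter fun i => blockIndex α i = j).card = α.getD j 0 := by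
  induction α generalizing j with
  | nil => simp
  | cons a α ih =>
    rw [Finset.card_filter, List.sum_cons, Finset.sum_range_add]
    have h1 : ∀ x ∈ Finset.range a, (if blockIndex (a :: α) x = j then 1 else 0) =
        if 0 = j then 1 else 0 := fun x hx => by
      rw [blockIndex_cons, if_pos (Finset.mem_range.1 hx)]
    have h2 : ∀ x ∈ Finset.range α.sum, (if blockIndex (a :: α) (a + x) = j then 1 else 0) =
        if blockIndex α x + 1 = j then 1 else 0 := fun x _ => by
      rw [blockIndex_cons, if_neg (Nat.le_add_right a x).not_gt, Nat.add_sub_cancel_left]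
    rw [Finset.sum_congr rfl h1, Finset.sum_congr rfl h2]
    cases j with
    | zero => simp
    | succ j =>
      simp only [Nat.add_right_cancel_iff, ← Finset.card_filter, ih]
      simp

theorem card_block {l : List ℕ} {n r : ℕ} (hn : l.sum = n) {b : Fin n → Fin r}
    (hb : ∀ p, (b p : ℕ) = blockIndex l p) (i : Fin r) :
    (Finset.univ.filter fun p => b p = i).card = l.getD i 0 := by
  subst hn
  rw [← card_blockIndex_eq, Finset.card_filter, Finset.card_filter,
    ← Fin.sum_univ_eq_sum_range fun p => if blockIndex l p = i then 1 else 0]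
  simp only [Fin.ext_iff, hb]

theorem getD_rowLens (μ : YoungDiagram) (i : Fin (μ.colLen 0)) :
    μ.rowLens.getD i 0 = μ.rowLen i := by
  rw [List.getD_eq_getElem _ _ (by simp), YoungDiagram.get_rowLens]

theorem doubleCosetSum_rowLens {μ ρ : YoungDiagram} (h : μ.card = ρ.card) :
    doubleCosetSum μ.rowLens ρ.rowLens = ∑ᶠ A : NMatrix μ ρ, matrixSign A.1 := by
  rw [card_eq_sum, card_eq_sum] at h
  rw [doubleCosetSum, if_pos h]
  have hlt : ∀ (ν : YoungDiagram), ν.rowLens.sum = ρ.rowLens.sum →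
      ∀ p : Fin ρ.rowLens.sum, blockIndex ν.rowLens p < ν.colLen 0 := fun ν hν p =>
    (blockIndex_lt (p.2.trans_eq hν.symm)).trans_eq YoungDiagram.length_rowLens
  let b : Fin ρ.rowLens.sum → Fin (μ.colLen 0) := fun p => ⟨_, hlt μ h p⟩
  let a : Fin ρ.rowLens.sum → Fin (ρ.colLen 0) := fun p => ⟨_, hlt ρ rfl p⟩
  have key := finsum_neg_one_pow_length (b := b) (a := a)
    (fun _ _ hpq => blockIndex_mono _ hpq) (fun _ _ hpq => blockIndex_mono _ hpq)
    (H := youngSubgroup _ μ.rowLens) (K := youngSubgroup _ ρ.rowLens)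
    (fun σ => forall_congr' fun p => by simp [b, Fin.ext_iff])
    (fun σ => forall_congr' fun p => by simp [a, Fin.ext_iff])
  refine key.trans (finsum_eq_of_bijective _ (Equiv.subtypeEquivRight fun A => ?_).bijective
    fun _ => rfl)
  simp only [card_block h (b := b) fun _ => rfl, card_block rfl (b := a) fun _ => rfl,
    getD_rowLens]

/-! ### The bilinear form on words of the free algebra. -/

theorem basisFreeMonoid_eq (k : Type*) [CommRing k] (w : FreeMonoid ℕ+) :
    FreeAlgebra.basisFreeMonoid k ℕ+ w = FreeMonoid.lift (FreeAlgebra.ι k) w := by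
  simp [FreeAlgebra.basisFreeMonoid, FreeAlgebra.equivMonoidAlgebraFreeMonoid]

theorem exists_word_eq (k : Type*) [CommRing k] {l : List ℕ} (hl : ∀ a ∈ l, 0 < a) :
    ∃ w : FreeMonoid ℕ+, (FreeMonoid.toList w).map PNat.val = l ∧
      (l.map (hGen k)).prod = FreeAlgebra.basisFreeMonoid k ℕ+ w := by
  induction l with
  | nil => exact ⟨1, rfl, by simp [basisFreeMonoid_eq]⟩
  | cons a l ih =>
    obtain ⟨w, hw, e⟩ := ih fun b hb => hl b (by simp [hb])
    have ha := hl a (by simp)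
    refine ⟨FreeMonoid.of (Nat.toPNat a ha) * w, congrArg (a :: ·) hw, ?_⟩
    rw [List.map_cons, List.prod_cons, e, hGen, dif_pos ha]
    simp only [basisFreeMonoid_eq, map_mul, FreeMonoid.lift_eval_of]
    rfl

theorem oddM'_eq (k : Type*) [CommRing k] {μ ρ : YoungDiagram} (h : μ.card = ρ.card) :
    oddM' k μ ρ = ((∑ᶠ A : NMatrix μ ρ, matrixSign A.1 : ℤ) : k) := by
  obtain ⟨w, hw, e⟩ := exists_word_eq k μ.pos_of_mem_rowLens
  obtain ⟨w', hw', e'⟩ := exists_word_eq k ρ.pos_of_mem_rowLens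
  rw [← doubleCosetSum_rowLens h, oddM', hPart, hPart, e, e', oddForm, Module.Basis.constr_basis,
    Module.Basis.constr_basis, hw, hw']

/-! ### The RSK correspondence -/

theorem rowLen_eq_zero (ρ : YoungDiagram) {k : ℕ} (h : ρ.colLen 0 ≤ k) : ρ.rowLen k = 0 := by
  by_contra hne
  have := YoungDiagram.mem_iff_lt_rowLen.2 (Nat.pos_of_ne_zero hne)
  exact (YoungDiagram.mem_iff_lt_colLen.1 this).not_ge h

theorem sum_ite_val_eq {r : ℕ} (f : Fin r → ℕ) (k : ℕ) :
    (∑ i : Fin r, if (i : ℕ) = k then f i else 0) = if h : k < r then f ⟨k, h⟩ else 0 := by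
  split_ifs with h
  · rw [Finset.sum_eq_single ⟨k, h⟩]
    · simp
    · intro b _ hb
      rw [if_neg fun e => hb (Fin.ext e)]
    · simp
  · exact Finset.sum_eq_zero fun i _ => if_neg fun e => h (e.symm.trans_lt i.2)

/-- Contents are indexed by all natural numbers and margins by `Fin r`; beyond the last part both
sides vanish. -/
theorem count_iff {r : ℕ} {ρ : YoungDiagram} (hr : r = ρ.colLen 0) (f : Fin r → ℕ) :
    (∀ k, (∑ i : Fin r, if (i : ℕ) = k then f i else 0) = ρ.rowLen k) ↔
      ∀ i, f i = ρ.rowLen i := by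
  simp only [sum_ite_val_eq]
  constructor
  · intro h i
    simpa using h i
  · intro h k
    split_ifs with hk
    · exact h _
    · exact (rowLen_eq_zero ρ (hr ▸ not_lt.1 hk)).symm

theorem exists_tableauPair {μ ρ : YoungDiagram} (A : NMatrix μ ρ) :
    ∃ T : TableauPair ρ μ, rsk A.1 = (rows T.1.2.1, rows T.1.2.2) := by
  have h := rskInv_foldl (pairwise_twoLineArray A.1)
  obtain ⟨lam, P, hP⟩ := exists_rows_eq h.tabP
  obtain ⟨lam', Q, hQ⟩ := exists_rows_eq h.tabQ
  have hsh := h.shape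
  rw [← hP, ← hQ, map_length_rows, map_length_rows] at hsh
  obtain rfl := rowLens_injective hsh
  refine ⟨⟨⟨lam, P, Q⟩, hasContent_iff.2 ?_, hasContent_iff.2 ?_⟩, ?_⟩
  · simp only [hP, h.permP.count_eq, count_map_snd_twoLineArray]
    exact (count_iff rfl _).2 A.2.2
  · simp only [hQ, h.permQ.count_eq, count_map_fst_twoLineArray]
    exact (count_iff rfl _).2 A.2.1
  · exact Prod.ext hP.symm hQ.symm

theorem exists_matrix {μ ρ : YoungDiagram} (T : TableauPair ρ μ) :
    ∃ A : NMatrix μ ρ, rsk A.1 = (rows T.1.2.1, rows T.1.2.2) := by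
  obtain ⟨⟨lam, P, Q⟩, hP, hQ⟩ := T
  rw [hasContent_iff] at hP hQ
  obtain ⟨L, hL, hrun⟩ := exists_foldl_rskStep_eq (isTab_rows P) (isTab_rows Q)
    (by rw [map_length_rows, map_length_rows])
  have h := rskInv_foldl hL
  rw [hrun] at h
  have hlt : ∀ {l : List ℕ} {ν : YoungDiagram}, (∀ k, l.count k = ν.rowLen k) → ∀ a ∈ l,
      a < ν.colLen 0 := by
    intro l ν hl a ha
    by_contra hlt
    have := (hl a).trans (rowLen_eq_zero ν (not_lt.1 hlt))
    exact List.count_eq_zero.1 this ha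
  simp only [h.permP.count_eq] at hP
  simp only [h.permQ.count_eq] at hQ
  obtain ⟨A, rfl⟩ := exists_twoLineArray_eq hL
    (fun p hp => hlt hQ p.1 (List.mem_map_of_mem hp))
    (fun p hp => hlt hP p.2 (List.mem_map_of_mem hp))
  simp only [count_map_fst_twoLineArray] at hQ
  simp only [count_map_snd_twoLineArray] at hP
  exact ⟨⟨A, (count_iff rfl _).1 hQ, (count_iff rfl _).1 hP⟩, hrun⟩

theorem rsk_injective {μ ρ : YoungDiagram} {A B : NMatrix μ ρ} (h : rsk A.1 = rsk B.1) : A = B :=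
  Subtype.ext (twoLineArray_injective
    (foldl_rskStep_injective (pairwise_twoLineArray _) (pairwise_twoLineArray _) h))

theorem tableauPair_ext {μ ρ : YoungDiagram} {T T' : TableauPair ρ μ}
    (hP : rows T.1.2.1 = rows T'.1.2.1) (hQ : rows T.1.2.2 = rows T'.1.2.2) : T = T' := by
  obtain ⟨⟨lam, P, Q⟩, h⟩ := T
  obtain ⟨⟨lam', P', Q'⟩, h'⟩ := T'
  have hsh := congrArg (List.map List.length) hP
  simp only [map_length_rows] at hsh
  obtain rfl := rowLens_injective hsh
  obtain rfl := rows_injective hP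
  obtain rfl := rows_injective hQ
  rfl

/-- The RSK correspondence. -/
noncomputable def rskEquiv (μ ρ : YoungDiagram) : NMatrix μ ρ ≃ TableauPair ρ μ :=
  Equiv.ofBijective (fun A => (exists_tableauPair A).choose) <| by
    have hs : ∀ A : NMatrix μ ρ, rsk A.1 = _ := fun A => (exists_tableauPair A).choose_spec
    refine ⟨fun A B h => rsk_injective ?_, fun T => ?_⟩
    · rw [hs A, hs B]
      simp only at h
      rw [h]
    · obtain ⟨A, hA⟩ := exists_matrix T
      have := (hs A).symm.trans hA
      rw [Prod.mk.injEq] at this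
      exact ⟨A, tableauPair_ext this.1 this.2⟩

theorem rsk_eq {μ ρ : YoungDiagram} (A : NMatrix μ ρ) :
    rsk A.1 = (rows (rskEquiv μ ρ A).1.2.1, rows (rskEquiv μ ρ A).1.2.2) :=
  (exists_tableauPair A).choose_spec

theorem matrixSign_eq_of_rsk_eq {r s : ℕ} {A : Matrix (Fin r) (Fin s) ℕ} {lam : YoungDiagram}
    {P Q : SemistandardYoungTableau lam} (h : rsk A = (rows P, rows Q)) :
    matrixSign A = (-1) ^ rowWeight lam.rowLens * tableauSign P * tableauSign Q := by
  have hs := (rskInv_foldl (pairwise_twoLineArray A)).sign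
  rw [show (twoLineArray A).foldl rskStep ([], []) = _ from h] at hs
  simp only [map_length_rows] at hs
  rw [matrixSign_eq, tableauSign_eq, tableauSign_eq, ← pow_add, ← pow_add,
    neg_one_pow_eq_pow_mod_two, ← hs, ← neg_one_pow_eq_pow_mod_two]
  congr 1
  omega

/-! ### The sum over shapes -/

theorem HasContent.card_eq {lam ρ : YoungDiagram} {T : SemistandardYoungTableau lam}
    (h : HasContent T ρ) : lam.card = ρ.card := by
  rw [card_eq_sum ρ, YoungDiagram.rowLens, sum_map_range, YoungDiagram.card,
    Finset.card_eq_sum_card_fiberwise (f := fun c => T c.1 c.2)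
      (t := Finset.range (ρ.colLen 0))]
  · exact Finset.sum_congr rfl fun k _ => h k
  · intro c hc
    by_contra hlt
    rw [Finset.coe_range, Set.mem_Iio, not_lt] at hlt
    have := (h (T c.1 c.2)).trans (rowLen_eq_zero ρ hlt)
    rw [Finset.card_eq_zero, Finset.filter_eq_empty_iff] at this
    exact this hc rfl

/-- Pairs of tableaux of the same shape, sorted by their shape. -/
noncomputable def tableauPairEquiv {n : ℕ} {ρ : YoungDiagram} (hρ : ρ.card = n)
    (μ : YoungDiagram) : TableauPair ρ μ ≃ (lam : partitionsOf n) ×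
      {T : SemistandardYoungTableau lam.1 // HasContent T ρ} ×
        {T : SemistandardYoungTableau lam.1 // HasContent T μ} where
  toFun T := ⟨⟨T.1.1, by simpa [partitionsOf] using T.2.1.card_eq.trans hρ⟩,
    ⟨T.1.2.1, T.2.1⟩, ⟨T.1.2.2, T.2.2⟩⟩
  invFun T := ⟨⟨T.1.1, T.2.1.1, T.2.2.1⟩, T.2.1.2, T.2.2.2⟩
  left_inv _ := rfl
  right_inv _ := rfl

theorem tableauSign_mul_self {lam : YoungDiagram} (T : SemistandardYoungTableau lam) :
    tableauSign T * tableauSign T = 1 := by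
  rw [tableauSign_eq, ← pow_add, ← two_mul, pow_mul]
  simp

theorem finsum_matrixSign {n : ℕ} {μ ρ : YoungDiagram} (hρ : ρ.card = n) :
    ∑ᶠ A : NMatrix μ ρ, matrixSign A.1 =
      ∑ lam ∈ partitionsOf n,
        (-1) ^ rowWeight lam.rowLens * oddKostka lam μ * oddKostka lam ρ := by
  classical
  have hfin : ∀ (lam ν : YoungDiagram),
      Fintype {T : SemistandardYoungTableau lam // HasContent T ν} := fun _ _ => Fintype.ofFinite _
  rw [finsum_eq_of_bijective (g := fun T => (-1 : ℤ) ^ rowWeight T.1.1.rowLens *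
      tableauSign T.2.1.1 * tableauSign T.2.2.1) _
    ((rskEquiv μ ρ).trans (tableauPairEquiv hρ μ)).bijective
    fun A => matrixSign_eq_of_rsk_eq (rsk_eq A), finsum_eq_sum_of_fintype, Fintype.sum_sigma,
    ← Finset.sum_coe_sort (partitionsOf n)]
  refine Finset.sum_congr rfl fun lam _ => ?_
  rw [oddKostka, oddKostka, finsum_eq_sum_of_fintype, finsum_eq_sum_of_fintype,
    Fintype.sum_prod_type]
  -- Here h is sign(T_λ), which squares to 1. The factors are swapped because Q has content μ and P
  -- has content ρ.
  have e : ∀ s x y h : ℤ, h * h = 1 → s * (h * x) * (h * y) = s * (y * x) := by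
    intro s x y h hh
    linear_combination s * x * y * hh
  rw [e _ _ _ _ (tableauSign_mul_self _), Finset.sum_mul_sum, Finset.mul_sum]
  refine Finset.sum_congr rfl fun P _ => ?_
  rw [Finset.mul_sum]
  exact Finset.sum_congr rfl fun Q _ => mul_assoc _ _ _

end OddRSK

theorem mainTheorem1 (n : ℕ) (μ ρ : YoungDiagram) (hμ : μ.card = n) (hρ : ρ.card = n) :
    (∃ RSK : OddRSK.NMatrix μ ρ ≃ OddRSK.TableauPair ρ μ,
      ∀ (A : OddRSK.NMatrix μ ρ) (lam : YoungDiagram) (P Q : SemistandardYoungTableau lam),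
        (RSK A).1 = ⟨lam, P, Q⟩ →
          OddRSK.rsk A.1 = (OddRSK.rows P, OddRSK.rows Q) ∧
          OddRSK.matrixSign A.1 =
            (-1) ^ (OddRSK.ang lam.transpose + lam.card) *
              OddRSK.tableauSign P * OddRSK.tableauSign Q) ∧
    ∀ (k : Type*) [CommRing k],
      OddRSK.oddM' k μ ρ =
        ∑ lam ∈ OddRSK.partitionsOf n, (-1) ^ (OddRSK.ang lam.transpose + lam.card) *
          (OddRSK.oddKostka lam μ : k) * (OddRSK.oddKostka lam ρ : k) ∧
      OddRSK.oddM' k μ ρ =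
        ∑ lam ∈ OddRSK.partitionsOf n, (-1) ^ OddRSK.evenRowSum lam *
          (OddRSK.oddKostka lam μ : k) * (OddRSK.oddKostka lam ρ : k) := by
  refine ⟨⟨OddRSK.rskEquiv μ ρ, fun A lam P Q h => ?_⟩, fun k _ => ?_⟩
  · have hA := OddRSK.rsk_eq A
    rw [h] at hA
    refine ⟨hA, ?_⟩
    rw [OddRSK.neg_one_pow_ang_transpose]
    exact OddRSK.matrixSign_eq_of_rsk_eq hA
  -- Parities are compared over ℤ and then transported to `k`, where 1 and -1 may coincide.
  · have hcast : ∀ {a b : ℕ}, (-1 : ℤ) ^ a = (-1) ^ b → (-1 : k) ^ a = (-1) ^ b := fun h => by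
      simpa using congrArg (Int.cast : ℤ → k) h
    rw [OddRSK.oddM'_eq k (hμ.trans hρ.symm), OddRSK.finsum_matrixSign hρ]
    push_cast
    exact ⟨Finset.sum_congr rfl fun lam _ => by
        rw [hcast (OddRSK.neg_one_pow_ang_transpose lam)],
      Finset.sum_congr rfl fun lam _ => by rw [hcast (OddRSK.neg_one_pow_evenRowSum lam)]⟩
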